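/- **Theorem 2 (Equivalence with the GGE).** Let $S$ be a quantum system with a Hilbert space of finite dimension $d\ge 1$, let $n\ge 1$, let $\mathcal Q=(Q^1,\dots,Q^n)$ be pairwise commuting observables (Hermitian operators) of $S$, and let $\boldsymbol\beta=(\beta^1,\dots,\beta^n)\in\mathbb R^n$ with $\beta^j\neq 0$ for all $j$. *Notation.* For commuting observables $\mathcal A=(A^1,\dots,A^n)$ of a finite-dimensional system, $\mathbf w\in\mathbb R^n$ and $\boldsymbol\lambda\in\mathbb R^n$, write $$[\mathbf w]_{\mathcal A}=\{\rho \text{ density matrix}:\operatorname{tr}(\rho A^j)=w^j\ \text{for all } j\},\qquad \gamma_{\boldsymbol\lambda}(\mathcal A)=\frac{e^{-\sum_j\lambda^jA^j}}{\operatorname{tr}\, e^{-\sum_j\lambda^jA^j}} .$$ For a vector $\mathbf v=(v^1,\dots,v^n)\in\mathbb R^n$, a generalised Gibbs ensemble (GGE) of the macrostate $(\mathbf v,\mathcal Q)$, denoted $\gamma_{\mathbf v}(\mathcal Q)$, is a state with $\operatorname{tr}(\gamma_{\mathbf v}(\mathcal Q)\,Q^j)=v^j$ for all $j$ that is of the form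 $\gamma_{\boldsymbol\lambda}(\mathcal Q)$ with $\boldsymbol\lambda\in\mathbb R^n$ or a limit of such states (limits, i.e. infinite multipliers, are needed only for extremal $\mathbf v$). An environment $E$ consists of finitely many systems $E^1,\dots,E^N$ of arbitrary finite positive dimensions, each with arbitrary pairwise commuting observables $\mathcal Q_{E^l}=(Q^1_{E^l},\dots,Q^n_{E^l})$. Put $Q^j_{SE}=Q^j+\sum_{l}Q^j_{E^l}$ (each summand acting on its own tensor factor), $v_{\boldsymbol\beta}(Q^j_{E^l})=\operatorname{tr}(\gamma_{\boldsymbol\beta}(\mathcal Q_{E^l})Q^j_{E^l})$ and $\mathbf v_{\boldsymbol\beta}(\mathcal Q_{E^l})=(v_{\boldsymbol\beta}(Q^1_{E^l}),\dots,v_{\boldsymbol\beta}(Q^n_{E^l}))$. For a unitary $U$ on $SE$, states $\rho$ of $S$, $\sigma_l$ of $E^l$ and $\rho_f$ of $S$, consider, with $\omega=\rho\otimes\sigma_1\otimes\cdots\otimes\sigma_N$, $$(\ast)\quad \big\|\operatorname{Tr}_E(U\omega U^\dagger)-\rho_f\big\|_1\le\epsilon\quad\text{and}\quad \big|\operatorname{tr}(U\omega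 U^\dagger Q^j_{SE})-\operatorname{tr}(\omega\, Q^j_{SE})\big|\le\epsilon'\ \text{ for all } j .$$ *Macrostate operations:* $(\mathbf v,\mathcal Q)\xrightarrow{\boldsymbol\beta\text{-mac}}\rho_f$ means that for all $\epsilon,\epsilon'>0$ there are an environment and a unitary $U$ on $SE$ such that $(\ast)$ holds simultaneously for all $\rho\in[\mathbf v]_{\mathcal Q}$ and all $\sigma_l\in[\mathbf v_{\boldsymbol\beta}(\mathcal Q_{E^l})]_{\mathcal Q_{E^l}}$, $l=1,\dots,N$. *Microstate operations:* $\rho\xrightarrow{\boldsymbol\beta\text{-mic}}\rho_f$ means that for all $\epsilon,\epsilon'>0$ there are an environment and a unitary $U$ on $SE$ such that $(\ast)$ holds for $\rho$ and $\sigma_l=\gamma_{\boldsymbol\beta}(\mathcal Q_{E^l})$, $l=1,\dots,N$. *Claim.* If $\gamma_{\mathbf v}(\mathcal Q)$ is a GGE of $(\mathbf v,\mathcal Q)$, then the macrostate $(\mathbf v,\mathcal Q)$ is operationally equivalent to it: for every density matrix $\rho_f$ of $S$, $$(\mathbf v,\mathcal Q)\xrightarrow{\boldsymbol\beta\text{-mac}}\rho_f\iff\gamma_{\mathbf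 v}(\mathcal Q)\xrightarrow{\boldsymbol\beta\text{-mic}}\rho_f .$$ -/

import Mathlib

open scoped Kronecker Matrix ComplexOrder

noncomputable section

/-- A density matrix (microstate): positive semidefinite with unit trace. -/
def IsDensityMatrix {ι : Type*} [Fintype ι] (ρ : Matrix ι ι ℂ) : Prop :=
  ρ.PosSemidef ∧ ρ.trace = 1

/-- A tuple of pairwise commuting observables (Hermitian matrices). -/
def IsCommutingObservables {ι : Type*} [Fintype ι] {n : ℕ}
    (Q : Fin n → Matrix ι ι ℂ) : Prop :=
  (∀ j, (Q j).IsHermitian) ∧ ∀ i j, Commute (Q i) (Q j)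

/-- The trace norm, i.e. the sum of the singular values. -/
def traceNorm {ι : Type*} [Fintype ι] [DecidableEq ι] (A : Matrix ι ι ℂ) : ℝ :=
  ∑ i, Real.sqrt ((Matrix.isHermitian_conjTranspose_mul_self A).eigenvalues i)

/-- The Gibbs state `exp (-∑ j, lam j * Q j) / tr (exp (-∑ j, lam j * Q j))` with
multipliers `lam`. -/
def gibbsState {ι : Type*} [Fintype ι] [DecidableEq ι] {n : ℕ}
    (lam : Fin n → ℝ) (Q : Fin n → Matrix ι ι ℂ) : Matrix ι ι ℂ :=
  (NormedSpace.exp (-∑ j, (lam j : ℂ) • Q j)).trace⁻¹ •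
    NormedSpace.exp (-∑ j, (lam j : ℂ) • Q j)

/-- The microstates compatible with the macrostate `(v, Q)`. -/
def compatibleStates {ι : Type*} [Fintype ι] {n : ℕ}
    (v : Fin n → ℝ) (Q : Fin n → Matrix ι ι ℂ) : Set (Matrix ι ι ℂ) :=
  {ρ | IsDensityMatrix ρ ∧ ∀ j, (ρ * Q j).trace = (v j : ℂ)}

/-- `γ` is the generalised Gibbs ensemble of the macrostate `(v, Q)`: it has the expectation
values `v` and is a Gibbs state of `Q` or a limit of such states. The limits are the ensembles with
infinite multipliers; they are needed only for extremal `v` (for example, the ground-state energy),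
where no finite multipliers reproduce `v`. -/
def IsGeneralisedGibbsEnsemble {ι : Type*} [Fintype ι] [DecidableEq ι] {n : ℕ}
    (v : Fin n → ℝ) (Q : Fin n → Matrix ι ι ℂ) (γ : Matrix ι ι ℂ) : Prop :=
  γ ∈ closure (Set.range fun lam : Fin n → ℝ => gibbsState lam Q) ∧
    ∀ j, (γ * Q j).trace = (v j : ℂ)

/-- The tensor product of a finite family of matrices. -/
def tensorFamily {N : ℕ} {κ : Fin N → Type} (A : ∀ l, Matrix (κ l) (κ l) ℂ) :
    Matrix (∀ l, κ l) (∀ l, κ l) ℂ :=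
  Matrix.of fun a b => ∏ l, A l (a l) (b l)

/-- The partial trace over the second factor. -/
def partialTraceRight {ι κ : Type*} [Fintype κ] (M : Matrix (ι × κ) (ι × κ) ℂ) :
    Matrix ι ι ℂ :=
  Matrix.of fun i i' => ∑ a, M (i, a) (i', a)

/-- An environment for `n` charges: finitely many finite-dimensional systems, each with `n`
commuting observables. -/
structure ChargedEnvironment (n : ℕ) where
  /-- the number of systems -/
  N : ℕ
  /-- the Hilbert space dimensions -/
  dim : Fin N → ℕ
  dim_pos : ∀ l, 0 < dim l
  /-- the charges of each system -/
  charge : ∀ l, Fin n → Matrix (Fin (dim l)) (Fin (dim l)) ℂ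
  charge_comm : ∀ l, IsCommutingObservables (charge l)

namespace ChargedEnvironment

variable {n : ℕ} (E : ChargedEnvironment n)

/-- The index set of the product basis of the environment. -/
abbrev Index : Type := ∀ l, Fin (E.dim l)

/-- The total `j`-th charge of the environment, the sum over `l` of
`1 ⊗ ⋯ ⊗ E.charge l j ⊗ ⋯ ⊗ 1`. -/
def totalCharge (j : Fin n) : Matrix E.Index E.Index ℂ :=
  ∑ l, tensorFamily (Function.update
    (fun m => (1 : Matrix (Fin (E.dim m)) (Fin (E.dim m)) ℂ)) l (E.charge l j))

/-- The expectation values of the charges of the `l`-th system in its Gibbs state with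
parameters `β`. -/
def thermalValue (β : Fin n → ℝ) (l : Fin E.N) (j : Fin n) : ℝ :=
  (gibbsState β (E.charge l) * E.charge l j).trace.re

/-- The total `j`-th charge of the compound of a system with charges `Q` and the environment. -/
def compoundCharge {ι : Type*} [DecidableEq ι] (Q : Fin n → Matrix ι ι ℂ) (j : Fin n) :
    Matrix (ι × E.Index) (ι × E.Index) ℂ :=
  Q j ⊗ₖ (1 : Matrix E.Index E.Index ℂ) + (1 : Matrix ι ι ℂ) ⊗ₖ E.totalCharge j

/-- From the initial state `ρ ⊗ (⨂ l, σ l)` of the compound, the unitary `U` produces `ρf` on the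
system up to `ε` in trace norm, and changes the mean value of each total charge by at most `ε'`. -/
def Implements {ι : Type*} [Fintype ι] [DecidableEq ι] (Q : Fin n → Matrix ι ι ℂ)
    (U : Matrix (ι × E.Index) (ι × E.Index) ℂ) (ρf : Matrix ι ι ℂ) (ε ε' : ℝ)
    (ρ : Matrix ι ι ℂ) (σ : ∀ l, Matrix (Fin (E.dim l)) (Fin (E.dim l)) ℂ) : Prop :=
  traceNorm (partialTraceRight (U * (ρ ⊗ₖ tensorFamily σ) * Uᴴ) - ρf) ≤ ε ∧
  ∀ j, ‖(U * (ρ ⊗ₖ tensorFamily σ) * Uᴴ * E.compoundCharge Q j).trace -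
    ((ρ ⊗ₖ tensorFamily σ) * E.compoundCharge Q j).trace‖ ≤ ε'

end ChargedEnvironment

/-- `ρf` can be reached from the macrostate `(v, Q)` by macrostate operations: one environment and
one unitary work for all microstates of system and environment that are compatible with the
given expectation values. -/
def MacroReachable {ι : Type*} [Fintype ι] [DecidableEq ι] {n : ℕ} (β : Fin n → ℝ)
    (v : Fin n → ℝ) (Q : Fin n → Matrix ι ι ℂ) (ρf : Matrix ι ι ℂ) : Prop :=
  ∀ ε > 0, ∀ ε' > 0, ∃ E : ChargedEnvironment n,
    ∃ U ∈ Matrix.unitaryGroup (ι × E.Index) ℂ,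
      ∀ ρ ∈ compatibleStates v Q,
      ∀ σ : ∀ l, Matrix (Fin (E.dim l)) (Fin (E.dim l)) ℂ,
        (∀ l, σ l ∈ compatibleStates (E.thermalValue β l) (E.charge l)) →
        E.Implements Q U ρf ε ε' ρ σ

/-- `ρf` can be reached from the microstate `ρ` by microstate operations: every system of the
environment is in its Gibbs state with parameters `β`. -/
def MicroReachable {ι : Type*} [Fintype ι] [DecidableEq ι] {n : ℕ} (β : Fin n → ℝ)
    (Q : Fin n → Matrix ι ι ℂ) (ρ ρf : Matrix ι ι ℂ) : Prop :=
  ∀ ε > 0, ∀ ε' > 0, ∃ E : ChargedEnvironment n,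
    ∃ U ∈ Matrix.unitaryGroup (ι × E.Index) ℂ,
      E.Implements Q U ρf ε ε' ρ (fun l => gibbsState β (E.charge l))

/-- The macrostate `(v, Q)` and the microstate `ρ` are operationally equivalent: they allow the
same transitions. -/
def OperationallyEquivalent {ι : Type*} [Fintype ι] [DecidableEq ι] {n : ℕ} (β : Fin n → ℝ)
    (v : Fin n → ℝ) (Q : Fin n → Matrix ι ι ℂ) (ρ : Matrix ι ι ℂ) : Prop :=
  ∀ ρf : Matrix ι ι ℂ, IsDensityMatrix ρf →
    (MacroReachable β v Q ρf ↔ MicroReachable β Q ρ ρf)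

end

/-!
On its support, the ensemble `γ` is the Gibbs state of `Q` with some finite multipliers `μ`, and
every state compatible with the macrostate lives on that support. If `q` denotes the joint
eigenvalues of `Q`, let `Θ` be rescaled charges, diagonal in the same basis, whose joint eigenvalues
`θ` satisfy `⟨β, θ⟩ = ⟨μ, q⟩`. Then `γ ⊗ τ`, with `τ` the thermal state of an environment, is on its
support a Gibbs state with the parameters `β` of the environment. Exchanging two of its levels with
the two levels of a thermal qubit whose charges make up the difference conserves the total charges
exactly. It acts on populations as a stochastic matrix that preserves those of `γ ⊗ τ`, and a
product of such exchanges, positive on the support, drives all populations there to the same limit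
when it is iterated (Doeblin); sign flips controlled by thermal qubits remove the coherences. Hence
one operation takes every compatible state close to `γ ⊗ τ`, and a unitary that works for the
microstate `γ` can be applied afterwards. The first stage conserves the rescaled charges rather than
the actual ones, but all compatible states agree with `γ` on the expectation values of both, so the
actual charges balance on average.
-/

noncomputable section

/-! ### Tensor products, partial traces and unitary conjugation -/

section TensorFamily

variable {N : ℕ} {κ : Fin N → Type}

theorem tensorFamily_apply (A : ∀ l, Matrix (κ l) (κ l) ℂ) (a b : ∀ l, κ l) :
    tensorFamily A a b = ∏ l, A l (a l) (b l) := rfl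

theorem conjTranspose_tensorFamily (A : ∀ l, Matrix (κ l) (κ l) ℂ) :
    (tensorFamily A)ᴴ = tensorFamily fun l => (A l)ᴴ := by
  ext a b
  simp [tensorFamily_apply, Matrix.conjTranspose_apply]

theorem tensorFamily_diagonal [∀ l, DecidableEq (κ l)] (d : ∀ l, κ l → ℂ) :
    tensorFamily (fun l => Matrix.diagonal (d l)) = Matrix.diagonal fun a => ∏ l, d l (a l) := by
  ext a b
  rw [tensorFamily_apply]
  rcases eq_or_ne a b with rfl | hab
  · simp
  · obtain ⟨l, hl⟩ := Function.ne_iff.1 hab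
    rw [Matrix.diagonal_apply_ne _ hab]
    exact Finset.prod_eq_zero (Finset.mem_univ l) (Matrix.diagonal_apply_ne _ hl)

theorem tensorFamily_one [∀ l, DecidableEq (κ l)] :
    tensorFamily (fun l => (1 : Matrix (κ l) (κ l) ℂ)) = 1 := by
  simpa using tensorFamily_diagonal (κ := κ) fun _ _ => 1

variable [∀ l, Fintype (κ l)]

theorem tensorFamily_mul_tensorFamily (A B : ∀ l, Matrix (κ l) (κ l) ℂ) :
    tensorFamily A * tensorFamily B = tensorFamily fun l => A l * B l := by
  ext a b
  simp only [tensorFamily_apply, Matrix.mul_apply, Finset.prod_univ_sum, Fintype.piFinset_univ,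
    Finset.prod_mul_distrib]

theorem trace_tensorFamily (A : ∀ l, Matrix (κ l) (κ l) ℂ) :
    (tensorFamily A).trace = ∏ l, (A l).trace := by
  simp only [Matrix.trace, Matrix.diag, tensorFamily_apply, Finset.prod_univ_sum,
    Fintype.piFinset_univ]

open scoped MatrixOrder in
theorem IsDensityMatrix.tensorFamily {σ : ∀ l, Matrix (κ l) (κ l) ℂ}
    (hσ : ∀ l, IsDensityMatrix (σ l)) : IsDensityMatrix (tensorFamily σ) := by
  classical
  refine ⟨?_, by simp [trace_tensorFamily, fun l => (hσ l).2]⟩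
  choose B hB using fun l =>
    CStarAlgebra.nonneg_iff_eq_star_mul_self.1 (Matrix.nonneg_iff_posSemidef.2 (hσ l).1)
  rw [show σ = fun l => (B l)ᴴ * B l from funext hB, ← tensorFamily_mul_tensorFamily,
    ← conjTranspose_tensorFamily]
  exact Matrix.posSemidef_conjTranspose_mul_self _

theorem tensorFamily_mem_unitaryGroup [∀ l, DecidableEq (κ l)] {V : ∀ l, Matrix (κ l) (κ l) ℂ}
    (hV : ∀ l, V l ∈ Matrix.unitaryGroup (κ l) ℂ) :
    tensorFamily V ∈ Matrix.unitaryGroup (∀ l, κ l) ℂ := by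
  rw [Matrix.mem_unitaryGroup_iff, Matrix.star_eq_conjTranspose, conjTranspose_tensorFamily,
    tensorFamily_mul_tensorFamily, ← tensorFamily_one]
  exact congrArg _ (funext fun l => Matrix.mem_unitaryGroup_iff.1 (hV l))

end TensorFamily

section Unitary

variable {X Y A : Type*} [Fintype X] [Fintype Y] [Fintype A]

theorem trace_submatrix (e : X ≃ Y) (M : Matrix Y Y ℂ) : (M.submatrix e e).trace = M.trace :=
  Equiv.sum_comp e fun y => M y y

theorem conj_submatrix (e : X ≃ Y) (W M : Matrix Y Y ℂ) :
    W.submatrix e e * M.submatrix e e * (W.submatrix e e)ᴴ = (W * M * Wᴴ).submatrix e e := by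
  rw [Matrix.conjTranspose_submatrix, Matrix.submatrix_mul_equiv, Matrix.submatrix_mul_equiv]

theorem commute_submatrix (e : X ≃ Y) {M N : Matrix Y Y ℂ} (h : Commute M N) :
    Commute (M.submatrix e e) (N.submatrix e e) := by
  rw [commute_iff_eq, Matrix.submatrix_mul_equiv, Matrix.submatrix_mul_equiv, h.eq]

variable [DecidableEq X] [DecidableEq Y] [DecidableEq A]

theorem submatrix_mem_unitaryGroup (e : X ≃ Y) {W : Matrix Y Y ℂ}
    (hW : W ∈ Matrix.unitaryGroup Y ℂ) : W.submatrix e e ∈ Matrix.unitaryGroup X ℂ := by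
  rw [Matrix.mem_unitaryGroup_iff, Matrix.star_eq_conjTranspose, Matrix.conjTranspose_submatrix,
    Matrix.submatrix_mul_equiv, show W * Wᴴ = 1 from Matrix.mem_unitaryGroup_iff.1 hW,
    Matrix.submatrix_one_equiv]

theorem kronecker_one_mem_unitaryGroup {W : Matrix X X ℂ} (hW : W ∈ Matrix.unitaryGroup X ℂ) :
    W ⊗ₖ (1 : Matrix A A ℂ) ∈ Matrix.unitaryGroup (X × A) ℂ :=
  Matrix.kronecker_mem_unitary hW (one_mem _)

theorem conjTranspose_mem_unitaryGroup {W : Matrix X X ℂ} (hW : W ∈ Matrix.unitaryGroup X ℂ) :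
    Wᴴ ∈ Matrix.unitaryGroup X ℂ :=
  Unitary.star_mem hW

theorem conjTranspose_mul_cancel {V : Matrix X X ℂ} (hV : V ∈ Matrix.unitaryGroup X ℂ)
    (M : Matrix X X ℂ) : Vᴴ * (V * M) = M := by
  rw [← mul_assoc, show Vᴴ * V = 1 from Matrix.mem_unitaryGroup_iff'.1 hV, one_mul]

theorem conj_conjTranspose_conj {V : Matrix X X ℂ} (hV : V ∈ Matrix.unitaryGroup X ℂ)
    (M : Matrix X X ℂ) : V * (Vᴴ * M * V) * Vᴴ = M := by
  have hVV : V * Vᴴ = 1 := Matrix.mem_unitaryGroup_iff.1 hV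
  rw [mul_assoc, mul_assoc, mul_assoc, hVV, mul_one, ← mul_assoc, hVV, one_mul]

theorem conjTranspose_conj_conj {V : Matrix X X ℂ} (hV : V ∈ Matrix.unitaryGroup X ℂ)
    (M : Matrix X X ℂ) : Vᴴ * (V * M * Vᴴ) * V = M := by
  simpa using conj_conjTranspose_conj (conjTranspose_mem_unitaryGroup hV) M

theorem trace_conj {V : Matrix X X ℂ} (hV : V ∈ Matrix.unitaryGroup X ℂ) (M : Matrix X X ℂ) :
    (V * M * Vᴴ).trace = M.trace := by
  rw [Matrix.trace_mul_comm, conjTranspose_mul_cancel hV]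

end Unitary

section PartialTrace

variable {X A : Type*} [Fintype A]

theorem partialTraceRight_apply (M : Matrix (X × A) (X × A) ℂ) (x y : X) :
    partialTraceRight M x y = ∑ a, M (x, a) (y, a) := rfl

theorem partialTraceRight_kronecker (ω : Matrix X X ℂ) (σ : Matrix A A ℂ) :
    partialTraceRight (ω ⊗ₖ σ) = σ.trace • ω := by
  ext x y
  simp [partialTraceRight_apply, Matrix.trace, mul_comm, Finset.mul_sum]

theorem continuous_partialTraceRight :
    Continuous (partialTraceRight : Matrix (X × A) (X × A) ℂ → Matrix X X ℂ) := by
  unfold partialTraceRight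
  fun_prop

theorem partialTraceRight_submatrix_prodCongr {B : Type*} [Fintype B] (f : B ≃ A)
    (M : Matrix (X × A) (X × A) ℂ) :
    partialTraceRight (M.submatrix (Equiv.prodCongr (Equiv.refl X) f)
      (Equiv.prodCongr (Equiv.refl X) f)) = partialTraceRight M := by
  ext x y
  exact Equiv.sum_comp f fun a => M (x, a) (y, a)

variable [Fintype X]

theorem trace_partialTraceRight (M : Matrix (X × A) (X × A) ℂ) :
    (partialTraceRight M).trace = M.trace := by
  simp [Matrix.trace, partialTraceRight_apply, Fintype.sum_prod_type]

theorem partialTraceRight_kronecker_one_mul [DecidableEq A] (C : Matrix X X ℂ)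
    (M : Matrix (X × A) (X × A) ℂ) :
    partialTraceRight ((C ⊗ₖ (1 : Matrix A A ℂ)) * M) = C * partialTraceRight M := by
  ext x y
  simp only [partialTraceRight_apply, Matrix.mul_apply, Fintype.sum_prod_type,
    Matrix.kronecker_apply, Matrix.one_apply, mul_ite, mul_one, mul_zero, ite_mul, zero_mul,
    Finset.sum_ite_eq, Finset.mem_univ, if_true, Finset.mul_sum]
  exact Finset.sum_comm

theorem partialTraceRight_mul_kronecker_one [DecidableEq A] (C : Matrix X X ℂ)
    (M : Matrix (X × A) (X × A) ℂ) :
    partialTraceRight (M * (C ⊗ₖ (1 : Matrix A A ℂ))) = partialTraceRight M * C := by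
  ext x y
  simp only [partialTraceRight_apply, Matrix.mul_apply, Fintype.sum_prod_type,
    Matrix.kronecker_apply, Matrix.one_apply, mul_ite, mul_one, mul_zero, Finset.sum_ite_eq',
    Finset.mem_univ, if_true, Finset.sum_mul]
  exact Finset.sum_comm

theorem partialTraceRight_conj_kronecker_one [DecidableEq A] (C : Matrix X X ℂ)
    (M : Matrix (X × A) (X × A) ℂ) :
    partialTraceRight ((C ⊗ₖ (1 : Matrix A A ℂ)) * M * (C ⊗ₖ (1 : Matrix A A ℂ))ᴴ) =
      C * partialTraceRight M * Cᴴ := by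
  rw [Matrix.conjTranspose_kronecker, Matrix.conjTranspose_one,
    partialTraceRight_mul_kronecker_one, partialTraceRight_kronecker_one_mul]

theorem conj_kronecker_one [DecidableEq A] (C ω : Matrix X X ℂ) (σ : Matrix A A ℂ) :
    (C ⊗ₖ (1 : Matrix A A ℂ)) * (ω ⊗ₖ σ) * (C ⊗ₖ (1 : Matrix A A ℂ))ᴴ = (C * ω * Cᴴ) ⊗ₖ σ := by
  simp [Matrix.conjTranspose_kronecker, ← Matrix.mul_kronecker_mul]

end PartialTrace

section Regroup

variable {X A B C : Type*}

/-- The regrouping `X × C ≃ (X × A) × B` induced by a splitting `C ≃ A × B` of the environment. -/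
def regroup (X : Type*) {A B C : Type*} (f : C ≃ A × B) : X × C ≃ (X × A) × B :=
  (Equiv.prodCongr (Equiv.refl X) f).trans (Equiv.prodAssoc X A B).symm

theorem regroup_apply (f : C ≃ A × B) (p : X × C) :
    regroup X f p = ((p.1, (f p.2).1), (f p.2).2) := rfl

theorem kronecker_submatrix_regroup (f : C ≃ A × B) (P : Matrix X X ℂ) (M : Matrix A A ℂ)
    (N : Matrix B B ℂ) :
    P ⊗ₖ (M ⊗ₖ N).submatrix f f = ((P ⊗ₖ M) ⊗ₖ N).submatrix (regroup X f) (regroup X f) := by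
  ext p q
  simp [regroup_apply, mul_assoc]

variable [Fintype A] [Fintype B] [Fintype C]

theorem partialTraceRight_submatrix_regroup (f : C ≃ A × B)
    (M : Matrix ((X × A) × B) ((X × A) × B) ℂ) :
    partialTraceRight (M.submatrix (regroup X f) (regroup X f)) =
      partialTraceRight (partialTraceRight M) := by
  ext x y
  simp only [partialTraceRight_apply, Matrix.submatrix_apply, regroup_apply]
  rw [← Fintype.sum_prod_type' (f := fun a b => M ((x, a), b) ((y, a), b))]
  exact Fintype.sum_equiv f _ _ fun c => rfl

theorem partialTraceRight_sequential [Fintype X] [DecidableEq A] [DecidableEq B] (f : C ≃ A × B)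
    (W₁ : Matrix (X × A) (X × A) ℂ) (W₂ : Matrix (X × B) (X × B) ℂ) (ω : Matrix X X ℂ)
    (σ₁ : Matrix A A ℂ) (σ₂ : Matrix B B ℂ) {U : Matrix (X × C) (X × C) ℂ}
    (hU : U = (W₂ ⊗ₖ (1 : Matrix A A ℂ)).submatrix (regroup X (f.trans (Equiv.prodComm A B)))
        (regroup X (f.trans (Equiv.prodComm A B))) *
      (W₁ ⊗ₖ (1 : Matrix B B ℂ)).submatrix (regroup X f) (regroup X f)) :
    partialTraceRight (U * ((ω ⊗ₖ σ₁) ⊗ₖ σ₂).submatrix (regroup X f) (regroup X f) * Uᴴ) =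
      partialTraceRight (W₂ * (partialTraceRight (W₁ * (ω ⊗ₖ σ₁) * W₁ᴴ) ⊗ₖ σ₂) * W₂ᴴ) := by
  set e₁ := regroup X f
  set e₂ := regroup X (f.trans (Equiv.prodComm A B))
  set Y := W₁ * (ω ⊗ₖ σ₁) * W₁ᴴ
  let Z : Matrix ((X × B) × A) ((X × B) × A) ℂ :=
    Matrix.of fun p q => Y (p.1.1, p.2) (q.1.1, q.2) * σ₂ p.1.2 q.1.2
  have hZ : (Y ⊗ₖ σ₂).submatrix e₁ e₁ = Z.submatrix e₂ e₂ := by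
    ext p q
    simp [e₁, e₂, Z, regroup_apply]
  have partialTraceRight_Z : partialTraceRight Z = partialTraceRight Y ⊗ₖ σ₂ := by
    ext p q
    simp [partialTraceRight_apply, Z, Finset.sum_mul]
  have conj_eq : U * ((ω ⊗ₖ σ₁) ⊗ₖ σ₂).submatrix e₁ e₁ * Uᴴ =
      ((W₂ ⊗ₖ (1 : Matrix A A ℂ)) * Z * (W₂ ⊗ₖ (1 : Matrix A A ℂ))ᴴ).submatrix e₂ e₂ := by
    rw [← conj_submatrix, ← hZ, ← conj_kronecker_one, ← conj_submatrix, hU,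
      Matrix.conjTranspose_mul]
    simp only [mul_assoc]
  rw [conj_eq, partialTraceRight_submatrix_regroup, partialTraceRight_conj_kronecker_one,
    partialTraceRight_Z]

end Regroup

section KroneckerSum

variable {X A B C : Type*} [DecidableEq X] [DecidableEq A] [DecidableEq B]

/-- The Kronecker sum `P ⊗ 1 + 1 ⊗ M`: the observable of a compound that adds `P` on the first
factor to `M` on the second. -/
def kroneckerSum (P : Matrix X X ℂ) (M : Matrix A A ℂ) : Matrix (X × A) (X × A) ℂ :=
  P ⊗ₖ (1 : Matrix A A ℂ) + (1 : Matrix X X ℂ) ⊗ₖ M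

theorem kroneckerSum_submatrix_regroup [DecidableEq C] (f : C ≃ A × B) (P : Matrix X X ℂ)
    (M : Matrix A A ℂ) (N : Matrix B B ℂ) :
    kroneckerSum P ((kroneckerSum M N).submatrix f f) =
      (kroneckerSum (kroneckerSum P M) N).submatrix (regroup X f) (regroup X f) := by
  have one_submatrix : (1 : Matrix C C ℂ) =
      ((1 : Matrix A A ℂ) ⊗ₖ (1 : Matrix B B ℂ)).submatrix f f := by
    rw [Matrix.one_kronecker_one, Matrix.submatrix_one_equiv]
  simp only [kroneckerSum]
  rw [one_submatrix, ← Matrix.one_kronecker_one (m := X) (n := A)]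
  ext p q
  simp only [Matrix.add_apply, Matrix.submatrix_apply, Matrix.kroneckerMap_apply, regroup_apply]
  ring

theorem kroneckerSum_submatrix_swap (f : C ≃ A × B) (M : Matrix A A ℂ) (N : Matrix B B ℂ) :
    (kroneckerSum M N).submatrix f f =
      (kroneckerSum N M).submatrix (f.trans (Equiv.prodComm A B))
        (f.trans (Equiv.prodComm A B)) := by
  ext p q
  exact (add_comm _ _).trans (congrArg₂ _ (mul_comm _ _) (mul_comm _ _))

theorem kroneckerSum_submatrix_prodCongr (f : B ≃ A) (P : Matrix X X ℂ) (M : Matrix A A ℂ) :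
    kroneckerSum P (M.submatrix f f) = (kroneckerSum P M).submatrix
      (Equiv.prodCongr (Equiv.refl X) f) (Equiv.prodCongr (Equiv.refl X) f) := by
  ext p q
  simp [kroneckerSum, Matrix.one_apply]

theorem kroneckerSum_diagonal (d : X → ℂ) (e : A → ℂ) :
    kroneckerSum (Matrix.diagonal d) (Matrix.diagonal e) =
      Matrix.diagonal fun p => d p.1 + e p.2 := by
  rw [kroneckerSum, ← Matrix.diagonal_one, ← Matrix.diagonal_one,
    Matrix.diagonal_kronecker_diagonal, Matrix.diagonal_kronecker_diagonal, Matrix.diagonal_add]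
  simp

variable [Fintype X] [Fintype A]

theorem commute_kronecker_one_kroneckerSum {W P : Matrix X X ℂ} (h : Commute W P)
    (M : Matrix A A ℂ) : Commute (W ⊗ₖ (1 : Matrix A A ℂ)) (kroneckerSum P M) := by
  rw [commute_iff_eq, kroneckerSum, mul_add, add_mul]
  simp only [← Matrix.mul_kronecker_mul, h.eq, one_mul, mul_one]

theorem conj_kroneckerSum {V : Matrix X X ℂ} (hV : V ∈ Matrix.unitaryGroup X ℂ)
    {G : Matrix A A ℂ} (hG : G ∈ Matrix.unitaryGroup A ℂ) (P : Matrix X X ℂ) (M : Matrix A A ℂ) :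
    (V ⊗ₖ G) * kroneckerSum P M * (V ⊗ₖ G)ᴴ = kroneckerSum (V * P * Vᴴ) (G * M * Gᴴ) := by
  simp only [kroneckerSum, mul_add, add_mul, Matrix.conjTranspose_kronecker,
    ← Matrix.mul_kronecker_mul, mul_one]
  rw [show V * Vᴴ = 1 from Matrix.mem_unitaryGroup_iff.1 hV,
    show G * Gᴴ = 1 from Matrix.mem_unitaryGroup_iff.1 hG]

theorem trace_kronecker_mul_kroneckerSum {ρ : Matrix X X ℂ} (hρ : ρ.trace = 1)
    {σ : Matrix A A ℂ} (hσ : σ.trace = 1) (P : Matrix X X ℂ) (M : Matrix A A ℂ) :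
    ((ρ ⊗ₖ σ) * kroneckerSum P M).trace = (ρ * P).trace + (σ * M).trace := by
  rw [kroneckerSum, mul_add, ← Matrix.mul_kronecker_mul, ← Matrix.mul_kronecker_mul,
    Matrix.trace_add, Matrix.trace_kronecker, Matrix.trace_kronecker]
  simp [hρ, hσ]

theorem trace_mul_kroneckerSum (Ξ : Matrix (X × A) (X × A) ℂ) (P : Matrix X X ℂ)
    (M : Matrix A A ℂ) :
    (Ξ * kroneckerSum P M).trace =
      (partialTraceRight Ξ * P).trace + (Ξ * ((1 : Matrix X X ℂ) ⊗ₖ M)).trace := by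
  rw [kroneckerSum, mul_add, Matrix.trace_add, ← trace_partialTraceRight,
    partialTraceRight_mul_kronecker_one]

end KroneckerSum

section DensityMatrix

variable {X A : Type*} [Fintype X] [Fintype A]

theorem IsDensityMatrix.partialTraceRight {M : Matrix (X × A) (X × A) ℂ}
    (hM : IsDensityMatrix M) : IsDensityMatrix (partialTraceRight M) := by
  refine ⟨?_, by rw [trace_partialTraceRight, hM.2]⟩
  have : _root_.partialTraceRight M = ∑ a, M.submatrix (fun x => (x, a)) fun x => (x, a) := by
    ext x y
    simp [partialTraceRight_apply, Matrix.sum_apply]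
  rw [this]
  exact Matrix.posSemidef_sum _ fun a _ => hM.1.submatrix _

theorem IsDensityMatrix.conj [DecidableEq X] {ρ V : Matrix X X ℂ} (hρ : IsDensityMatrix ρ)
    (hV : V ∈ Matrix.unitaryGroup X ℂ) : IsDensityMatrix (V * ρ * Vᴴ) :=
  ⟨hρ.1.mul_mul_conjTranspose_same V, by rw [trace_conj hV, hρ.2]⟩

theorem IsDensityMatrix.conjTranspose_conj [DecidableEq X] {ρ V : Matrix X X ℂ}
    (hρ : IsDensityMatrix ρ) (hV : V ∈ Matrix.unitaryGroup X ℂ) :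
    IsDensityMatrix (Vᴴ * ρ * V) := by
  simpa only [Matrix.conjTranspose_conjTranspose] using
    hρ.conj (conjTranspose_mem_unitaryGroup hV)

theorem IsDensityMatrix.kronecker {ρ : Matrix X X ℂ} {σ : Matrix A A ℂ}
    (hρ : IsDensityMatrix ρ) (hσ : IsDensityMatrix σ) : IsDensityMatrix (ρ ⊗ₖ σ) :=
  ⟨hρ.1.kronecker hσ.1, by rw [Matrix.trace_kronecker, hρ.2, hσ.2, one_mul]⟩

/-- The populations of a state in the chosen basis: its diagonal as a vector of reals. -/
def populations (ω : Matrix X X ℂ) (x : X) : ℝ := (ω x x).re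

theorem IsDensityMatrix.apply_self_eq {ω : Matrix X X ℂ} (hω : IsDensityMatrix ω) (x : X) :
    ω x x = (populations ω x : ℂ) :=
  (Complex.conj_eq_iff_re.1 (hω.1.1.apply x x)).symm

theorem IsDensityMatrix.populations_mem_stdSimplex {ω : Matrix X X ℂ} (hω : IsDensityMatrix ω) :
    populations ω ∈ stdSimplex ℝ X := by
  classical
  refine ⟨fun x => (Complex.le_def.1 (hω.1.diag_nonneg (i := x))).1, ?_⟩
  simpa [Matrix.trace, populations] using congrArg Complex.re hω.2

theorem IsDensityMatrix.norm_apply_le_one {ω : Matrix X X ℂ} (hω : IsDensityMatrix ω) (x y : X) :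
    ‖ω x y‖ ≤ 1 := by
  have hdet := (hω.1.submatrix ![x, y]).det_nonneg
  rw [Matrix.det_fin_two] at hdet
  simp only [Matrix.submatrix_apply, Matrix.cons_val_zero, Matrix.cons_val_one] at hdet
  rw [← hω.1.1.apply y x, hω.apply_self_eq x, hω.apply_self_eq y, Complex.star_def,
    Complex.mul_conj, ← Complex.ofReal_mul, ← Complex.ofReal_sub, Complex.zero_le_real, sub_nonneg,
    Complex.normSq_eq_norm_sq] at hdet
  have le_one_x := (mem_Icc_of_mem_stdSimplex hω.populations_mem_stdSimplex x).2
  obtain ⟨nonneg_y, le_one_y⟩ := mem_Icc_of_mem_stdSimplex hω.populations_mem_stdSimplex y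
  nlinarith [norm_nonneg (ω x y), mul_le_one₀ le_one_x nonneg_y le_one_y]

end DensityMatrix

section SiteOperator

variable {N : ℕ} {κ : Fin N → Type} [∀ l, DecidableEq (κ l)]

/-- The operator `1 ⊗ ⋯ ⊗ A ⊗ ⋯ ⊗ 1` that acts as `A` on the `l`-th tensor factor. -/
def siteOperator (l : Fin N) (A : Matrix (κ l) (κ l) ℂ) : Matrix (∀ l, κ l) (∀ l, κ l) ℂ :=
  tensorFamily (Function.update (fun m => (1 : Matrix (κ m) (κ m) ℂ)) l A)

theorem siteOperator_diagonal (l : Fin N) (d : κ l → ℂ) :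
    siteOperator l (Matrix.diagonal d) = Matrix.diagonal fun a => d (a l) := by
  have update_eq : Function.update (fun m => (1 : Matrix (κ m) (κ m) ℂ)) l (Matrix.diagonal d) =
      fun m => Matrix.diagonal (Function.update (fun m (_ : κ m) => (1 : ℂ)) l d m) := by
    funext m
    rcases eq_or_ne m l with rfl | hm
    · simp
    · simp [Function.update_of_ne hm]
  rw [siteOperator, update_eq, tensorFamily_diagonal]
  congr 1
  funext a
  rw [Finset.prod_eq_single_of_mem l (Finset.mem_univ l) fun m _ hm => by
    rw [Function.update_of_ne hm], Function.update_self]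

variable [∀ l, Fintype (κ l)]

theorem conj_siteOperator {V : ∀ l, Matrix (κ l) (κ l) ℂ}
    (hV : ∀ l, V l ∈ Matrix.unitaryGroup (κ l) ℂ) (l : Fin N) (A : Matrix (κ l) (κ l) ℂ) :
    tensorFamily V * siteOperator l A * (tensorFamily V)ᴴ =
      siteOperator l (V l * A * (V l)ᴴ) := by
  rw [siteOperator, conjTranspose_tensorFamily, tensorFamily_mul_tensorFamily,
    tensorFamily_mul_tensorFamily, siteOperator]
  congr 1
  funext m
  rcases eq_or_ne m l with rfl | hm
  · simp
  · rw [Function.update_of_ne hm, Function.update_of_ne hm, mul_one]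
    exact Matrix.mem_unitaryGroup_iff.1 (hV m)

theorem trace_tensorFamily_mul_siteOperator {σ : ∀ l, Matrix (κ l) (κ l) ℂ}
    (hσ : ∀ l, IsDensityMatrix (σ l)) (l : Fin N) (A : Matrix (κ l) (κ l) ℂ) :
    (tensorFamily σ * siteOperator l A).trace = (σ l * A).trace := by
  rw [siteOperator, tensorFamily_mul_tensorFamily, trace_tensorFamily,
    Finset.prod_eq_single_of_mem l (Finset.mem_univ l) fun m _ hm => by
      rw [Function.update_of_ne hm, mul_one, (hσ m).2], Function.update_self]

end SiteOperator

namespace ChargedEnvironment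

variable {n : ℕ}

/-- The families of microstates of the single systems of `E` that are compatible with the thermal
values of the charges. -/
def thermalStates (E : ChargedEnvironment n) (β : Fin n → ℝ) :
    Set (∀ l, Matrix (Fin (E.dim l)) (Fin (E.dim l)) ℂ) :=
  {σ | ∀ l, σ l ∈ compatibleStates (E.thermalValue β l) (E.charge l)}

theorem totalCharge_eq_sum_siteOperator (E : ChargedEnvironment n) (j : Fin n) :
    E.totalCharge j = ∑ l, siteOperator l (E.charge l j) := rfl

theorem compoundCharge_eq_kroneckerSum {X : Type*} [DecidableEq X] (E : ChargedEnvironment n)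
    (Q : Fin n → Matrix X X ℂ) (j : Fin n) :
    E.compoundCharge Q j = kroneckerSum (Q j) (E.totalCharge j) := rfl

theorem isDensityMatrix_tensorFamily {E : ChargedEnvironment n} {β : Fin n → ℝ}
    {σ : ∀ l, Matrix (Fin (E.dim l)) (Fin (E.dim l)) ℂ} (hσ : σ ∈ E.thermalStates β) :
    IsDensityMatrix (tensorFamily σ) :=
  IsDensityMatrix.tensorFamily fun l => (hσ l).1

theorem trace_tensorFamily_mul_totalCharge {E : ChargedEnvironment n} {β : Fin n → ℝ}
    {σ : ∀ l, Matrix (Fin (E.dim l)) (Fin (E.dim l)) ℂ} (hσ : σ ∈ E.thermalStates β)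
    (j : Fin n) :
    (tensorFamily σ * E.totalCharge j).trace = ∑ l, (E.thermalValue β l j : ℂ) := by
  rw [totalCharge_eq_sum_siteOperator, Finset.mul_sum, Matrix.trace_sum]
  refine Finset.sum_congr rfl fun l _ => ?_
  rw [trace_tensorFamily_mul_siteOperator fun m => (hσ m).1, (hσ l).2 j]

/-! #### Joining environments -/

/-- The environment without systems. -/
def empty (n : ℕ) : ChargedEnvironment n where
  N := 0
  dim := finZeroElim
  dim_pos := finZeroElim
  charge := finZeroElim
  charge_comm := finZeroElim

/-- The environment that consists of a single system of dimension `d` with charges `Q`. -/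
def ofSystem {d : ℕ} [NeZero d] {Q : Fin n → Matrix (Fin d) (Fin d) ℂ}
    (hQ : IsCommutingObservables Q) : ChargedEnvironment n where
  N := 1
  dim _ := d
  dim_pos _ := NeZero.pos d
  charge _ := Q
  charge_comm _ := hQ

section OfSystem

variable {d : ℕ} [NeZero d] {Q : Fin n → Matrix (Fin d) (Fin d) ℂ}

/-- The product basis of an environment with a single system. -/
def ofSystemIndex (hQ : IsCommutingObservables Q) : (ofSystem hQ).Index ≃ Fin d :=
  Equiv.funUnique (Fin 1) (Fin d)

theorem tensorFamily_ofSystem (hQ : IsCommutingObservables Q)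
    (σ : ∀ l, Matrix (Fin ((ofSystem hQ).dim l)) (Fin ((ofSystem hQ).dim l)) ℂ) :
    tensorFamily σ = (σ (0 : Fin 1)).submatrix (ofSystemIndex hQ) (ofSystemIndex hQ) := by
  ext a b
  exact Fin.prod_univ_one fun l => σ l (a l) (b l)

theorem totalCharge_ofSystem (hQ : IsCommutingObservables Q) (j : Fin n) :
    (ofSystem hQ).totalCharge j = (Q j).submatrix (ofSystemIndex hQ) (ofSystemIndex hQ) := by
  rw [totalCharge_eq_sum_siteOperator]
  exact (Fin.sum_univ_one _).trans ((tensorFamily_ofSystem hQ _).trans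
    (congrArg (fun M => Matrix.submatrix M _ _) (Function.update_self (0 : Fin 1) _ _)))

end OfSystem

section Append

variable (E F : ChargedEnvironment n)

/-- The dimensions of the systems of `E` and `F`. -/
def appendDim : Fin E.N ⊕ Fin F.N → ℕ := Sum.elim E.dim F.dim

/-- The charges of the systems of `E` and `F`. -/
def appendCharge :
    ∀ s, Fin n → Matrix (Fin (E.appendDim F s)) (Fin (E.appendDim F s)) ℂ
  | Sum.inl l => E.charge l
  | Sum.inr l => F.charge l

/-- The environment that consists of the systems of `E` and those of `F`. -/
def append : ChargedEnvironment n where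
  N := E.N + F.N
  dim k := E.appendDim F (finSumFinEquiv.symm k)
  dim_pos k := by
    rcases finSumFinEquiv.symm k with l | l
    · exact E.dim_pos l
    · exact F.dim_pos l
  charge k := E.appendCharge F (finSumFinEquiv.symm k)
  charge_comm k := by
    rcases finSumFinEquiv.symm k with l | l
    · exact E.charge_comm l
    · exact F.charge_comm l

/-- The product basis of the joint environment as pairs of basis elements of its two parts. -/
def appendIndex : (E.append F).Index ≃ E.Index × F.Index :=
  (Equiv.piCongrLeft' (fun s => Fin (E.appendDim F s)) finSumFinEquiv).symm.trans
    (Equiv.sumPiEquivProdPi fun s => Fin (E.appendDim F s))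

theorem tensorFamily_append
    (σ : ∀ s, Matrix (Fin (E.appendDim F s)) (Fin (E.appendDim F s)) ℂ) :
    (tensorFamily fun k => σ (finSumFinEquiv.symm k) :
      Matrix (E.append F).Index (E.append F).Index ℂ) =
      ((tensorFamily fun l => σ (Sum.inl l) : Matrix E.Index E.Index ℂ) ⊗ₖ
        (tensorFamily fun l => σ (Sum.inr l) : Matrix F.Index F.Index ℂ)).submatrix
        (E.appendIndex F) (E.appendIndex F) := by
  let split := Equiv.piCongrLeft' (fun s => Fin (E.appendDim F s)) finSumFinEquiv
  have appendIndex_split (a) :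
      E.appendIndex F (split a) = (fun l => a (Sum.inl l), fun l => a (Sum.inr l)) :=
    congrArg (Equiv.sumPiEquivProdPi fun s => Fin (E.appendDim F s)) (split.symm_apply_apply a)
  ext a b
  obtain ⟨a, rfl⟩ := split.surjective a
  obtain ⟨b, rfl⟩ := split.surjective b
  exact ((Equiv.prod_comp finSumFinEquiv.symm fun s => σ s (a s) (b s)).trans
    (Fintype.prod_sum_type _)).trans
    (congrArg₂ (tensorFamily (fun l => σ (Sum.inl l)) ⊗ₖ tensorFamily fun l => σ (Sum.inr l))
      (appendIndex_split a) (appendIndex_split b)).symm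

theorem exists_tensorFamily_append {β : Fin n → ℝ}
    {σ : ∀ k, Matrix (Fin ((E.append F).dim k)) (Fin ((E.append F).dim k)) ℂ}
    (hσ : σ ∈ (E.append F).thermalStates β) :
    ∃ σE ∈ E.thermalStates β, ∃ σF ∈ F.thermalStates β,
      tensorFamily σ = (tensorFamily σE ⊗ₖ tensorFamily σF).submatrix
        (E.appendIndex F) (E.appendIndex F) := by
  obtain ⟨τ, rfl⟩ := (Equiv.piCongrLeft'
    (fun s => Matrix (Fin (E.appendDim F s)) (Fin (E.appendDim F s)) ℂ)
    finSumFinEquiv).surjective σ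
  have hτ : ∀ s, τ s ∈ compatibleStates
      (fun j => (gibbsState β (E.appendCharge F s) * E.appendCharge F s j).trace.re)
      (E.appendCharge F s) :=
    finSumFinEquiv.symm.surjective.forall.2 hσ
  exact ⟨fun l => τ (Sum.inl l), fun l => hτ (Sum.inl l), fun l => τ (Sum.inr l),
    fun l => hτ (Sum.inr l), E.tensorFamily_append F τ⟩

theorem totalCharge_append (j : Fin n) :
    (E.append F).totalCharge j = (kroneckerSum (E.totalCharge j) (F.totalCharge j)).submatrix
      (E.appendIndex F) (E.appendIndex F) := by
  let one (s : Fin E.N ⊕ Fin F.N) : Matrix (Fin (E.appendDim F s)) (Fin (E.appendDim F s)) ℂ := 1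
  let update (s) := Function.update one s (E.appendCharge F s j)
  have sum_eq : (E.append F).totalCharge j = ∑ s,
      (tensorFamily fun k => update s (finSumFinEquiv.symm k) :
        Matrix (E.append F).Index (E.append F).Index ℂ) := by
    rw [← Equiv.sum_comp finSumFinEquiv.symm, totalCharge_eq_sum_siteOperator]
    exact Finset.sum_congr rfl fun k _ => congrArg tensorFamily
      (Function.update_comp_eq_of_injective' one finSumFinEquiv.symm.injective k
        (E.appendCharge F (finSumFinEquiv.symm k) j)).symm
  have inl_eq (l : Fin E.N) : (tensorFamily fun k => update (Sum.inl l) (finSumFinEquiv.symm k) :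
        Matrix (E.append F).Index (E.append F).Index ℂ) =
      (siteOperator l (E.charge l j) ⊗ₖ (1 : Matrix F.Index F.Index ℂ)).submatrix
        (E.appendIndex F) (E.appendIndex F) := by
    rw [tensorFamily_append, ← tensorFamily_one]
    congr 2
    exact congrArg tensorFamily (Function.update_comp_eq_of_injective' _ Sum.inl_injective l _)
  have inr_eq (l : Fin F.N) : (tensorFamily fun k => update (Sum.inr l) (finSumFinEquiv.symm k) :
        Matrix (E.append F).Index (E.append F).Index ℂ) =
      ((1 : Matrix E.Index E.Index ℂ) ⊗ₖ siteOperator l (F.charge l j)).submatrix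
        (E.appendIndex F) (E.appendIndex F) := by
    rw [tensorFamily_append, ← tensorFamily_one]
    congr 2
    exact congrArg tensorFamily (Function.update_comp_eq_of_injective' _ Sum.inr_injective l _)
  rw [sum_eq, Fintype.sum_sum_type]
  simp only [inl_eq, inr_eq]
  ext p q
  simp [kroneckerSum, totalCharge_eq_sum_siteOperator, Matrix.sum_apply, Finset.sum_mul,
    Finset.mul_sum]

theorem compoundCharge_append {X : Type*} [DecidableEq X] (Q : Fin n → Matrix X X ℂ)
    (j : Fin n) :
    (E.append F).compoundCharge Q j = (F.compoundCharge (E.compoundCharge Q) j).submatrix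
      (regroup X (E.appendIndex F)) (regroup X (E.appendIndex F)) := by
  simp only [compoundCharge_eq_kroneckerSum, totalCharge_append, kroneckerSum_submatrix_regroup]

theorem compoundCharge_append_swap {X : Type*} [DecidableEq X] (Q : Fin n → Matrix X X ℂ)
    (j : Fin n) :
    (E.append F).compoundCharge Q j = (E.compoundCharge (F.compoundCharge Q) j).submatrix
      (regroup X ((E.appendIndex F).trans (Equiv.prodComm _ _)))
      (regroup X ((E.appendIndex F).trans (Equiv.prodComm _ _))) := by
  rw [compoundCharge_eq_kroneckerSum, totalCharge_append, kroneckerSum_submatrix_swap,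
    kroneckerSum_submatrix_regroup]
  rfl

end Append

end ChargedEnvironment

/-! ### Operations with thermal environments -/

/-- The relation `R` between initial and final states of a system with charges `Θ` is enforced by a
single unitary on the system and some environment that commutes with all total charges, whichever
microstates with the thermal expectation values the systems of the environment are in. -/
def ThermallyAchievable {X : Type*} [Fintype X] [DecidableEq X] {n : ℕ} (β : Fin n → ℝ)
    (Θ : Fin n → Matrix X X ℂ) (R : Matrix X X ℂ → Matrix X X ℂ → Prop) : Prop :=
  ∃ F : ChargedEnvironment n, ∃ W ∈ Matrix.unitaryGroup (X × F.Index) ℂ,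
    (∀ j, Commute W (F.compoundCharge Θ j)) ∧
    ∀ ω, IsDensityMatrix ω → ∀ σ ∈ F.thermalStates β,
      R ω (partialTraceRight (W * (ω ⊗ₖ tensorFamily σ) * Wᴴ))

namespace ThermallyAchievable

variable {X : Type*} [Fintype X] [DecidableEq X] {n : ℕ} {β : Fin n → ℝ}
  {Θ : Fin n → Matrix X X ℂ} {R R₁ R₂ : Matrix X X ℂ → Matrix X X ℂ → Prop}

theorem mono (h₁ : ThermallyAchievable β Θ R₁)
    (h₁₂ : ∀ ω ω', IsDensityMatrix ω → IsDensityMatrix ω' → R₁ ω ω' → R₂ ω ω') :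
    ThermallyAchievable β Θ R₂ := by
  obtain ⟨F, W, hW, hWΘ, hR⟩ := h₁
  exact ⟨F, W, hW, hWΘ, fun ω hω σ hσ => h₁₂ _ _ hω
    ((hω.kronecker (ChargedEnvironment.isDensityMatrix_tensorFamily hσ)).conj hW).partialTraceRight
    (hR ω hω σ hσ)⟩

theorem refl (β : Fin n → ℝ) (Θ : Fin n → Matrix X X ℂ) :
    ThermallyAchievable β Θ fun ω ω' => ω' = ω := by
  refine ⟨.empty n, 1, one_mem _, fun j => Commute.one_left _, fun ω _ σ hσ => ?_⟩
  rw [Matrix.conjTranspose_one, one_mul, mul_one, partialTraceRight_kronecker,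
    (ChargedEnvironment.isDensityMatrix_tensorFamily hσ).2, one_smul]

theorem comp (h₁ : ThermallyAchievable β Θ R₁) (h₂ : ThermallyAchievable β Θ R₂) :
    ThermallyAchievable β Θ fun ω ω'' => ∃ ω', IsDensityMatrix ω' ∧ R₁ ω ω' ∧ R₂ ω' ω'' := by
  obtain ⟨F₁, W₁, hW₁, hW₁Θ, hR₁⟩ := h₁
  obtain ⟨F₂, W₂, hW₂, hW₂Θ, hR₂⟩ := h₂
  refine ⟨F₁.append F₂, _,
    mul_mem (submatrix_mem_unitaryGroup
        (regroup X ((F₁.appendIndex F₂).trans (Equiv.prodComm _ _)))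
        (kronecker_one_mem_unitaryGroup (A := F₁.Index) hW₂))
      (submatrix_mem_unitaryGroup (regroup X (F₁.appendIndex F₂))
        (kronecker_one_mem_unitaryGroup (A := F₂.Index) hW₁)),
    fun j => Commute.mul_left ?_ ?_, fun ω hω σ hσ => ?_⟩
  · rw [F₁.compoundCharge_append_swap F₂]
    exact commute_submatrix _ (commute_kronecker_one_kroneckerSum (hW₂Θ j) _)
  · rw [F₁.compoundCharge_append F₂]
    exact commute_submatrix _ (commute_kronecker_one_kroneckerSum (hW₁Θ j) _)
  · obtain ⟨σ₁, hσ₁, σ₂, hσ₂, hσ_eq⟩ := F₁.exists_tensorFamily_append F₂ hσ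
    have hω' : IsDensityMatrix (partialTraceRight (W₁ * (ω ⊗ₖ tensorFamily σ₁) * W₁ᴴ)) :=
      ((hω.kronecker (ChargedEnvironment.isDensityMatrix_tensorFamily hσ₁)).conj
        hW₁).partialTraceRight
    refine ⟨_, hω', hR₁ ω hω σ₁ hσ₁, ?_⟩
    rw [hσ_eq, kronecker_submatrix_regroup,
      partialTraceRight_sequential (F₁.appendIndex F₂) W₁ W₂ _ _ _ rfl]
    exact hR₂ _ hω' σ₂ hσ₂

theorem conj (h : ThermallyAchievable β Θ R) {V : Matrix X X ℂ}
    (hV : V ∈ Matrix.unitaryGroup X ℂ) :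
    ThermallyAchievable β (fun j => V * Θ j * Vᴴ) fun ω ω' => R (Vᴴ * ω * V) (Vᴴ * ω' * V) := by
  obtain ⟨F, W, hW, hWΘ, hR⟩ := h
  set V₁ := V ⊗ₖ (1 : Matrix F.Index F.Index ℂ)
  have hV₁ : V₁ ∈ Matrix.unitaryGroup (X × F.Index) ℂ := kronecker_one_mem_unitaryGroup hV
  have charge_eq (j : Fin n) :
      F.compoundCharge (fun j => V * Θ j * Vᴴ) j = V₁ * F.compoundCharge Θ j * V₁ᴴ := by
    simp only [ChargedEnvironment.compoundCharge_eq_kroneckerSum, V₁,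
      conj_kroneckerSum hV (one_mem _), Matrix.conjTranspose_one, one_mul, mul_one]
  refine ⟨F, V₁ * W * V₁ᴴ, mul_mem (mul_mem hV₁ hW) (conjTranspose_mem_unitaryGroup hV₁),
    fun j => ?_, fun ω hω σ hσ => ?_⟩
  · rw [charge_eq, Commute, SemiconjBy]
    simp only [mul_assoc, conjTranspose_mul_cancel hV₁, (hWΘ j).left_comm]
  · set ω₀ := Vᴴ * ω * V
    have initial_eq : ω ⊗ₖ tensorFamily σ = V₁ * (ω₀ ⊗ₖ tensorFamily σ) * V₁ᴴ := by
      rw [conj_kronecker_one, conj_conjTranspose_conj hV]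
    have final_eq : V₁ * W * V₁ᴴ * (ω ⊗ₖ tensorFamily σ) * (V₁ * W * V₁ᴴ)ᴴ =
        V₁ * (W * (ω₀ ⊗ₖ tensorFamily σ) * Wᴴ) * V₁ᴴ := by
      rw [initial_eq, Matrix.conjTranspose_mul, Matrix.conjTranspose_mul,
        Matrix.conjTranspose_conjTranspose]
      simp only [mul_assoc, conjTranspose_mul_cancel hV₁]
    rw [final_eq, partialTraceRight_conj_kronecker_one, conjTranspose_conj_conj hV]
    exact hR _ (hω.conjTranspose_conj hV) σ hσ

theorem of_system {d : ℕ} [NeZero d] {C : Fin n → Matrix (Fin d) (Fin d) ℂ}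
    (hC : IsCommutingObservables C) {W : Matrix (X × Fin d) (X × Fin d) ℂ}
    (hW : W ∈ Matrix.unitaryGroup (X × Fin d) ℂ)
    (hWC : ∀ j, Commute W (kroneckerSum (Θ j) (C j)))
    (hR : ∀ ω, IsDensityMatrix ω →
      ∀ σ ∈ compatibleStates (fun j => (gibbsState β C * C j).trace.re) C,
        R ω (partialTraceRight (W * (ω ⊗ₖ σ) * Wᴴ))) :
    ThermallyAchievable β Θ R := by
  refine ⟨.ofSystem hC, _, submatrix_mem_unitaryGroup
    (Equiv.prodCongr (Equiv.refl X) (ChargedEnvironment.ofSystemIndex hC)) hW, fun j => ?_,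
    fun ω hω σ hσ => ?_⟩
  · rw [ChargedEnvironment.compoundCharge_eq_kroneckerSum,
      ChargedEnvironment.totalCharge_ofSystem, kroneckerSum_submatrix_prodCongr]
    exact commute_submatrix _ (hWC j)
  · let σ₀ : Matrix (Fin d) (Fin d) ℂ := σ (0 : Fin 1)
    have initial_eq : ω ⊗ₖ tensorFamily σ = (ω ⊗ₖ σ₀).submatrix
        (Equiv.prodCongr (Equiv.refl X) (ChargedEnvironment.ofSystemIndex hC))
        (Equiv.prodCongr (Equiv.refl X) (ChargedEnvironment.ofSystemIndex hC)) :=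
      congrArg (ω ⊗ₖ ·) (ChargedEnvironment.tensorFamily_ofSystem hC σ)
    rw [initial_eq, conj_submatrix, partialTraceRight_submatrix_prodCongr]
    exact hR ω hω σ₀ (hσ (0 : Fin 1))

end ThermallyAchievable

/-! ### Spectral decompositions -/

section TraceNorm

variable {X : Type*} [Fintype X] [DecidableEq X]

theorem traceNorm_eq_trace_cfc (A : Matrix X X ℂ) :
    (traceNorm A : ℂ) = (cfc Real.sqrt (Aᴴ * A)).trace := by
  rw [(Matrix.isHermitian_conjTranspose_mul_self A).cfc_eq, Matrix.IsHermitian.cfc,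
    Unitary.conjStarAlgAut_apply, Matrix.trace_mul_comm, ← mul_assoc]
  simp [traceNorm, Matrix.trace_diagonal]

open scoped Matrix.Norms.L2Operator in
theorem continuous_traceNorm : Continuous (traceNorm : Matrix X X ℂ → ℝ) := by
  have continuous_cfc : Continuous fun A : Matrix X X ℂ => cfc Real.sqrt (Aᴴ * A) :=
    Continuous.cfc_of_mem_nhdsSet (s := Set.univ) Real.sqrt Filter.univ_mem
      (by fun_prop) (fun A => Matrix.isHermitian_conjTranspose_mul_self A)
      Real.continuous_sqrt.continuousOn
  have continuous_coe : Continuous fun A : Matrix X X ℂ => (traceNorm A : ℂ) := by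
    simp_rw [traceNorm_eq_trace_cfc]
    exact continuous_cfc.matrix_trace
  exact Complex.continuous_re.comp continuous_coe

end TraceNorm

section OfSpectrum

variable {X A : Type*} [Fintype X] [DecidableEq X] [Fintype A] [DecidableEq A]

/-- The Hermitian matrix with eigenvalues `d` for the eigenvectors that form the columns of the
unitary `V`. -/
def ofSpectrum (V : Matrix X X ℂ) (d : X → ℝ) : Matrix X X ℂ :=
  V * Matrix.diagonal (fun x => (d x : ℂ)) * Vᴴ

theorem continuous_ofSpectrum (V : Matrix X X ℂ) : Continuous (ofSpectrum V) := by
  unfold ofSpectrum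
  fun_prop

theorem isDensityMatrix_ofSpectrum {V : Matrix X X ℂ} (hV : V ∈ Matrix.unitaryGroup X ℂ)
    {p : X → ℝ} (hp : p ∈ stdSimplex ℝ X) : IsDensityMatrix (ofSpectrum V p) := by
  refine IsDensityMatrix.conj ⟨Matrix.PosSemidef.diagonal fun x => ?_, ?_⟩ hV
  · exact Complex.zero_le_real.2 (hp.1 x)
  · rw [Matrix.trace_diagonal, ← Complex.ofReal_sum, hp.2, Complex.ofReal_one]

theorem populations_conj_ofSpectrum {V : Matrix X X ℂ} (hV : V ∈ Matrix.unitaryGroup X ℂ)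
    (d : X → ℝ) : populations (Vᴴ * ofSpectrum V d * V) = d := by
  rw [ofSpectrum, conjTranspose_conj_conj hV]
  funext x
  simp [populations]

theorem IsDensityMatrix.trace_mul_ofSpectrum {ω V : Matrix X X ℂ} (hω : IsDensityMatrix ω)
    (hV : V ∈ Matrix.unitaryGroup X ℂ) (d : X → ℝ) :
    (ω * ofSpectrum V d).trace = ((populations (Vᴴ * ω * V) ⬝ᵥ d : ℝ) : ℂ) := by
  have hω' := hω.conjTranspose_conj hV
  rw [ofSpectrum, ← mul_assoc, Matrix.trace_mul_comm, ← mul_assoc, ← mul_assoc, Matrix.trace]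
  simp [Matrix.mul_diagonal, hω'.apply_self_eq, dotProduct]

theorem kroneckerSum_ofSpectrum {V : Matrix X X ℂ} (hV : V ∈ Matrix.unitaryGroup X ℂ)
    {G : Matrix A A ℂ} (hG : G ∈ Matrix.unitaryGroup A ℂ) (d : X → ℝ) (e : A → ℝ) :
    kroneckerSum (ofSpectrum V d) (ofSpectrum G e) =
      ofSpectrum (V ⊗ₖ G) fun p => d p.1 + e p.2 := by
  simp only [ofSpectrum, ← conj_kroneckerSum hV hG, kroneckerSum_diagonal, Complex.ofReal_add]

theorem ofSpectrum_kronecker (V : Matrix X X ℂ) (G : Matrix A A ℂ) (p : X → ℝ) (r : A → ℝ) :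
    ofSpectrum V p ⊗ₖ ofSpectrum G r = ofSpectrum (V ⊗ₖ G) fun z => p z.1 * r z.2 := by
  simp only [ofSpectrum, Matrix.mul_kronecker_mul, Matrix.conjTranspose_kronecker,
    Matrix.diagonal_kronecker_diagonal, Complex.ofReal_mul]

theorem tensorFamily_ofSpectrum {N : ℕ} {κ : Fin N → Type} [∀ l, Fintype (κ l)]
    [∀ l, DecidableEq (κ l)] (G : ∀ l, Matrix (κ l) (κ l) ℂ) (r : ∀ l, κ l → ℝ) :
    tensorFamily (fun l => ofSpectrum (G l) (r l)) =
      ofSpectrum (tensorFamily G) fun a => ∏ l, r l (a l) := by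
  simp only [ofSpectrum, ← tensorFamily_mul_tensorFamily, ← conjTranspose_tensorFamily,
    tensorFamily_diagonal, Complex.ofReal_prod]

theorem ChargedEnvironment.totalCharge_eq_ofSpectrum {n : ℕ} (E : ChargedEnvironment n)
    {G : ∀ l, Matrix (Fin (E.dim l)) (Fin (E.dim l)) ℂ}
    (hG : ∀ l, G l ∈ Matrix.unitaryGroup (Fin (E.dim l)) ℂ)
    {r : ∀ l, Matrix (Fin (E.dim l)) (Fin n) ℝ}
    (hr : ∀ l, E.charge l = fun j => ofSpectrum (G l) ((r l).col j)) (j : Fin n) :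
    E.totalCharge j = ofSpectrum (tensorFamily G) fun a => ∑ l, r l (a l) j := by
  have diagonal_eq : Matrix.diagonal (fun a : E.Index => ((∑ l, r l (a l) j : ℝ) : ℂ)) =
      ∑ l, siteOperator l (Matrix.diagonal fun x => (r l x j : ℂ)) := by
    simp only [siteOperator_diagonal]
    ext a b
    by_cases hab : a = b <;> simp [Matrix.sum_apply, hab]
  rw [E.totalCharge_eq_sum_siteOperator, ofSpectrum, diagonal_eq, Finset.mul_sum, Finset.sum_mul]
  exact Finset.sum_congr rfl fun l _ => by rw [conj_siteOperator hG, hr]; rfl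

end OfSpectrum

section Diagonalisation

variable {X : Type*} [Fintype X] [DecidableEq X] {n : ℕ}

theorem IsCommutingObservables.exists_orthonormalBasis {Q : Fin n → Matrix X X ℂ}
    (hQ : IsCommutingObservables Q) :
    ∃ (b : OrthonormalBasis X ℂ (EuclideanSpace ℂ X)) (q : X → Fin n → ℂ),
      ∀ x j, Matrix.toEuclideanLin (Q j) (b x) = q x j • b x := by
  classical
  set T : Fin n → Module.End ℂ (EuclideanSpace ℂ X) := fun j => Matrix.toEuclideanLin (Q j)
  have hT : ∀ j, (T j).IsSymmetric := fun j => Matrix.isSymmetric_toEuclideanLin_iff.2 (hQ.1 j)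
  have commute_T : Pairwise (Function.onFun Commute T) := fun i j _ =>
    (hQ.2 i j).map (Matrix.toLpLinAlgEquiv 2)
  let eigenspace (χ : Fin n → ℂ) := ⨅ j, Module.End.eigenspace (T j) (χ j)
  have isInternal : DirectSum.IsInternal eigenspace :=
    LinearMap.IsSymmetric.directSum_isInternal_of_pairwise_commute hT commute_T
  have : Fintype {χ // eigenspace χ ≠ ⊥} :=
    (WellFoundedGT.finite_ne_bot_of_iSupIndep isInternal.submodule_iSupIndep).fintype
  have isInternal' : DirectSum.IsInternal fun χ : {χ // eigenspace χ ≠ ⊥} => eigenspace χ :=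
    DirectSum.isInternal_ne_bot_iff.2 isInternal
  have orthogonal : OrthogonalFamily ℂ (fun χ : {χ // eigenspace χ ≠ ⊥} => eigenspace χ)
      fun χ => (eigenspace χ).subtypeₗᵢ :=
    (LinearMap.IsSymmetric.orthogonalFamily_iInf_eigenspaces hT).comp Subtype.val_injective
  have finrank_eq : Module.finrank ℂ (EuclideanSpace ℂ X) = Fintype.card X :=
    finrank_euclideanSpace
  refine ⟨(isInternal'.subordinateOrthonormalBasis finrank_eq orthogonal).reindex
    (Fintype.equivFin X).symm, fun x => (isInternal'.subordinateOrthonormalBasisIndex finrank_eq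
      (Fintype.equivFin X x) orthogonal).1, fun x j => ?_⟩
  have mem_eigenspace := isInternal'.subordinateOrthonormalBasis_subordinate finrank_eq
    (Fintype.equivFin X x) orthogonal
  simpa using Module.End.mem_eigenspace_iff.1 ((Submodule.mem_iInf _).1 mem_eigenspace j)

theorem IsCommutingObservables.exists_ofSpectrum {Q : Fin n → Matrix X X ℂ}
    (hQ : IsCommutingObservables Q) :
    ∃ V ∈ Matrix.unitaryGroup X ℂ, ∃ q : Matrix X (Fin n) ℝ,
      Q = fun j => ofSpectrum V (q.col j) := by
  obtain ⟨b, q, hb⟩ := hQ.exists_orthonormalBasis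
  set V : Matrix X X ℂ := (EuclideanSpace.basisFun X ℂ).toBasis.toMatrix b
  have hV : V ∈ Matrix.unitaryGroup X ℂ :=
    OrthonormalBasis.toMatrix_orthonormalBasis_mem_unitary _ _
  have re_eq (x : X) (j : Fin n) : ((q x j).re : ℂ) = q x j :=
    Complex.conj_eq_iff_re.1
      ((Matrix.isSymmetric_toEuclideanLin_iff.2 (hQ.1 j)).conj_eigenvalue_eq_self
        (Module.End.hasEigenvalue_of_hasEigenvector
          ⟨Module.End.mem_eigenspace_iff.2 (hb x j), b.orthonormal.ne_zero x⟩))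
  refine ⟨V, hV, Matrix.of fun x j => (q x j).re, funext fun j => ?_⟩
  have mul_eq : Q j * V = V * Matrix.diagonal (fun x => q x j) := by
    ext a x
    rw [Matrix.mul_diagonal, Matrix.mul_apply]
    simpa [Matrix.toLpLin_apply, Matrix.mulVec, dotProduct, V, Module.Basis.toMatrix_apply,
      mul_comm] using congrArg (fun y : EuclideanSpace ℂ X => y a) (hb x j)
  simp only [ofSpectrum, Matrix.col_apply, Matrix.of_apply, re_eq]
  rw [← mul_eq, mul_assoc, show V * Vᴴ = 1 from Matrix.mem_unitaryGroup_iff.1 hV, mul_one]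

end Diagonalisation

section GibbsWeight

variable {X : Type*} [Fintype X]

/-- The Gibbs distribution with weights proportional to `exp (-u x)`. -/
def gibbsWeight (u : X → ℝ) (x : X) : ℝ := Real.exp (-u x) / ∑ y, Real.exp (-u y)

theorem gibbsWeight_pos (u : X → ℝ) (x : X) : 0 < gibbsWeight u x :=
  div_pos (Real.exp_pos _) (Finset.sum_pos (fun _ _ => Real.exp_pos _) ⟨x, Finset.mem_univ x⟩)

theorem gibbsWeight_mem_stdSimplex [Nonempty X] (u : X → ℝ) : gibbsWeight u ∈ stdSimplex ℝ X := by
  refine ⟨fun x => (gibbsWeight_pos u x).le, ?_⟩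
  simp only [gibbsWeight]
  rw [← Finset.sum_div, div_self (Finset.sum_pos (fun _ _ => Real.exp_pos _)
    Finset.univ_nonempty).ne']

theorem gibbsState_ofSpectrum [DecidableEq X] {n : ℕ} {V : Matrix X X ℂ}
    (hV : V ∈ Matrix.unitaryGroup X ℂ) (lam : Fin n → ℝ) (q : Matrix X (Fin n) ℝ) :
    gibbsState lam (fun j => ofSpectrum V (q.col j)) =
      ofSpectrum V (gibbsWeight (q *ᵥ lam)) := by
  have hVV : V * Vᴴ = 1 := Matrix.mem_unitaryGroup_iff.1 hV
  have inv_eq : V⁻¹ = Vᴴ := Matrix.inv_eq_right_inv hVV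
  have diagonal_eq : Matrix.diagonal (fun x => ((-(q *ᵥ lam) x : ℝ) : ℂ)) =
      -∑ j, (lam j : ℂ) • Matrix.diagonal (fun x => (q x j : ℂ)) := by
    ext x y
    by_cases hxy : x = y <;>
      simp [Matrix.sum_apply, Matrix.mulVec, dotProduct, mul_comm, hxy]
  have exponent_eq : -∑ j, (lam j : ℂ) • ofSpectrum V (q.col j) =
      V * Matrix.diagonal (fun x => ((-(q *ᵥ lam) x : ℝ) : ℂ)) * V⁻¹ := by
    rw [diagonal_eq, inv_eq]
    simp only [ofSpectrum, Matrix.col_apply, mul_neg, neg_mul, Finset.mul_sum, Finset.sum_mul,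
      Matrix.mul_smul, Matrix.smul_mul]
  have exp_eq : NormedSpace.exp (-∑ j, (lam j : ℂ) • ofSpectrum V (q.col j)) =
      ofSpectrum V fun x => Real.exp (-(q *ᵥ lam) x) := by
    rw [exponent_eq, Matrix.exp_conj _ _ (.of_mul_eq_one _ hVV), inv_eq, Matrix.exp_diagonal,
      ofSpectrum]
    congr 3
    funext x
    simp [← Complex.exp_eq_exp_ℂ]
  rw [gibbsState, exp_eq]
  simp only [ofSpectrum, trace_conj hV]
  rw [Matrix.trace_diagonal, ← Matrix.smul_mul, ← Matrix.mul_smul, ← Matrix.diagonal_smul]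
  congr 3
  funext x
  simp [gibbsWeight, div_eq_inv_mul]

end GibbsWeight

/-! ### Elementary operations with a thermal qubit -/

section PermTransition

variable {X A : Type*} [Fintype A] [DecidableEq X]

/-- The stochastic matrix by which a permutation `π` of the basis of a compound changes the
populations of the first factor when the second factor starts with populations `w`. -/
def permTransition (π : Equiv.Perm (X × A)) (w : A → ℝ) : Matrix X X ℝ :=
  Matrix.of fun x y => ∑ a, if (π (x, a)).1 = y then w (π (x, a)).2 else 0

theorem permTransition_nonneg (π : Equiv.Perm (X × A)) {w : A → ℝ} (hw : ∀ a, 0 ≤ w a) (x y : X) :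
    0 ≤ permTransition π w x y :=
  Finset.sum_nonneg fun a _ => by split_ifs; exacts [hw _, le_rfl]

theorem permTransition_pos (π : Equiv.Perm (X × A)) {w : A → ℝ} (hw : ∀ a, 0 < w a) (x : X)
    (a : A) : 0 < permTransition π w x (π (x, a)).1 :=
  Finset.sum_pos' (fun b _ => by split_ifs; exacts [(hw _).le, le_rfl])
    ⟨a, Finset.mem_univ a, by simpa using hw _⟩

variable [Fintype X]

theorem permTransition_mulVec (π : Equiv.Perm (X × A)) (w : A → ℝ) (p : X → ℝ) (x : X) :
    (permTransition π w *ᵥ p) x = ∑ a, p (π (x, a)).1 * w (π (x, a)).2 := by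
  simp only [permTransition, Matrix.mulVec, dotProduct, Matrix.of_apply, Finset.sum_mul]
  rw [Finset.sum_comm]
  simp [mul_comm]

theorem permTransition_mem_colStochastic (π : Equiv.Perm (X × A)) {w : A → ℝ}
    (hw : w ∈ stdSimplex ℝ A) : permTransition π w ∈ Matrix.colStochastic ℝ X := by
  refine Matrix.mem_colStochastic_iff_sum.2 ⟨permTransition_nonneg π hw.1, fun y => ?_⟩
  calc ∑ x, permTransition π w x y
      = ∑ z : X × A, if (π z).1 = y then w (π z).2 else 0 :=
      (Fintype.sum_prod_type (f := fun z => if (π z).1 = y then w (π z).2 else 0)).symm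
    _ = ∑ z : X × A, if z.1 = y then w z.2 else 0 :=
      Equiv.sum_comp π fun z => if z.1 = y then w z.2 else 0
    _ = 1 := by simp [Fintype.sum_prod_type_right, hw.2]

variable [DecidableEq A]

theorem populations_conj_permMatrix (π : Equiv.Perm (X × A)) {ω : Matrix X X ℂ} {σ : Matrix A A ℂ}
    (hω : IsDensityMatrix ω) (hσ : IsDensityMatrix σ) :
    populations (partialTraceRight (π.permMatrix ℂ * (ω ⊗ₖ σ) * (π.permMatrix ℂ)ᴴ)) =
      permTransition π (populations σ) *ᵥ populations ω := by
  have conj_eq : π.permMatrix ℂ * (ω ⊗ₖ σ) * (π.permMatrix ℂ)ᴴ = (ω ⊗ₖ σ).submatrix π π := by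
    rw [Matrix.conjTranspose_permMatrix, Equiv.Perm.permMatrix, Equiv.Perm.permMatrix,
      PEquiv.toMatrix_toPEquiv_mul, PEquiv.mul_toMatrix_toPEquiv]
    rfl
  funext x
  rw [conj_eq, permTransition_mulVec, populations, partialTraceRight_apply, Complex.re_sum]
  refine Finset.sum_congr rfl fun a _ => ?_
  rw [Matrix.submatrix_apply, Matrix.kroneckerMap_apply, hω.apply_self_eq, hσ.apply_self_eq,
    ← Complex.ofReal_mul, Complex.ofReal_re]

theorem permMatrix_mem_unitaryGroup (π : Equiv.Perm X) :
    π.permMatrix ℂ ∈ Matrix.unitaryGroup X ℂ := by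
  rw [Matrix.mem_unitaryGroup_iff, Matrix.star_eq_conjTranspose, Matrix.conjTranspose_permMatrix,
    ← Matrix.permMatrix_mul, inv_mul_cancel, Matrix.permMatrix_one]

theorem commute_permMatrix_diagonal {π : Equiv.Perm X} {d : X → ℂ} (hd : ∀ x, d (π x) = d x) :
    Commute (π.permMatrix ℂ) (Matrix.diagonal d) := by
  rw [Commute, SemiconjBy, Equiv.Perm.permMatrix, PEquiv.toMatrix_toPEquiv_mul,
    PEquiv.mul_toMatrix_toPEquiv]
  ext x y
  simp only [Matrix.submatrix_apply, id, Matrix.diagonal_apply, Equiv.eq_symm_apply, hd]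

end PermTransition

section DiagonalCharge

variable {X A : Type*} [Fintype X] [DecidableEq X] [Fintype A] [DecidableEq A] {n : ℕ}

theorem ofSpectrum_one (d : X → ℝ) :
    ofSpectrum 1 d = Matrix.diagonal fun x => (d x : ℂ) := by
  rw [ofSpectrum, Matrix.conjTranspose_one, one_mul, mul_one]

/-- Charges that are diagonal in the standard basis, with the values `θ x j`. -/
def diagonalCharge (θ : Matrix X (Fin n) ℝ) (j : Fin n) : Matrix X X ℂ := ofSpectrum 1 (θ.col j)

theorem isCommutingObservables_diagonalCharge (θ : Matrix X (Fin n) ℝ) :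
    IsCommutingObservables (diagonalCharge θ) := by
  simp only [IsCommutingObservables, diagonalCharge, ofSpectrum_one]
  refine ⟨fun j => Matrix.isHermitian_diagonal_of_self_adjoint _ ?_,
    fun i j => Matrix.commute_diagonal _ _⟩
  ext x
  simp

theorem kroneckerSum_diagonalCharge (θ : Matrix X (Fin n) ℝ) (r : Matrix A (Fin n) ℝ)
    (j : Fin n) : kroneckerSum (diagonalCharge θ j) (diagonalCharge r j) =
      Matrix.diagonal fun z : X × A => ((θ z.1 j + r z.2 j : ℝ) : ℂ) := by
  rw [diagonalCharge, diagonalCharge, kroneckerSum_ofSpectrum (one_mem _) (one_mem _),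
    Matrix.one_kronecker_one, ofSpectrum_one]
  rfl

end DiagonalCharge

section Qubit

variable {n : ℕ}

/-- The charge values of a qubit whose two levels differ by `y`. -/
def qubitLevels (y : Fin n → ℝ) : Matrix (Fin 2) (Fin n) ℝ := Matrix.of ![0, y]

/-- The populations of the thermal state of a qubit whose two levels differ by `y`. -/
def qubitWeight (β y : Fin n → ℝ) : Fin 2 → ℝ := gibbsWeight (qubitLevels y *ᵥ β)

theorem qubitWeight_pos (β y : Fin n → ℝ) (i : Fin 2) : 0 < qubitWeight β y i :=
  gibbsWeight_pos _ i

theorem qubitWeight_zero_add_one (β y : Fin n → ℝ) :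
    qubitWeight β y 0 + qubitWeight β y 1 = 1 :=
  (Fin.sum_univ_two _).symm.trans (gibbsWeight_mem_stdSimplex (qubitLevels y *ᵥ β)).2

theorem populations_eq_qubitWeight {β y : Fin n → ℝ} (hy : y ≠ 0) {σ : Matrix (Fin 2) (Fin 2) ℂ}
    (hσ : σ ∈ compatibleStates
      (fun j =>
        (gibbsState β (diagonalCharge (qubitLevels y)) * diagonalCharge (qubitLevels y) j).trace.re)
      (diagonalCharge (qubitLevels y))) :
    populations σ = qubitWeight β y := by
  have hw : qubitWeight β y ∈ stdSimplex ℝ (Fin 2) := gibbsWeight_mem_stdSimplex _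
  have hp := hσ.1.populations_mem_stdSimplex
  obtain ⟨j, hj⟩ := Function.ne_iff.1 hy
  have gibbs_eq : gibbsState β (diagonalCharge (qubitLevels y)) = ofSpectrum 1 (qubitWeight β y) :=
    gibbsState_ofSpectrum (one_mem _) β (qubitLevels y)
  have excited_eq : populations σ 1 = qubitWeight β y 1 := by
    have mean_eq := hσ.2 j
    beta_reduce at mean_eq
    rw [gibbs_eq, diagonalCharge, hσ.1.trace_mul_ofSpectrum (one_mem _),
      (isDensityMatrix_ofSpectrum (one_mem _) hw).trace_mul_ofSpectrum (one_mem _),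
      Complex.ofReal_re, Complex.ofReal_inj, populations_conj_ofSpectrum (one_mem _)] at mean_eq
    simpa [dotProduct, Fin.sum_univ_two, qubitLevels, show y j ≠ 0 from hj] using mean_eq
  have sum_eq := hp.2.trans hw.2.symm
  rw [Fin.sum_univ_two, Fin.sum_univ_two, excited_eq, add_left_inj] at sum_eq
  funext i
  fin_cases i
  exacts [sum_eq, excited_eq]

end Qubit

section QubitOperation

variable {X : Type*} [Fintype X] [DecidableEq X] {n : ℕ} {β : Fin n → ℝ} {θ : Matrix X (Fin n) ℝ}

theorem ThermallyAchievable.of_qubit {y : Fin n → ℝ} (hy : y ≠ 0)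
    {W : Matrix (X × Fin 2) (X × Fin 2) ℂ} (hW : W ∈ Matrix.unitaryGroup (X × Fin 2) ℂ)
    (hWθ : ∀ j, Commute W (Matrix.diagonal fun z : X × Fin 2 =>
      ((θ z.1 j + qubitLevels y z.2 j : ℝ) : ℂ)))
    {R : Matrix X X ℂ → Matrix X X ℂ → Prop}
    (hR : ∀ ω, IsDensityMatrix ω → ∀ σ, IsDensityMatrix σ → populations σ = qubitWeight β y →
      R ω (partialTraceRight (W * (ω ⊗ₖ σ) * Wᴴ))) :
    ThermallyAchievable β (diagonalCharge θ) R := by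
  refine .of_system (isCommutingObservables_diagonalCharge (qubitLevels y)) hW (fun j => ?_)
    fun ω hω σ hσ => hR ω hω σ hσ.1 (populations_eq_qubitWeight hy hσ)
  rw [kroneckerSum_diagonalCharge]
  exact hWθ j

/-- The stochastic matrices by which the populations of a system with charges `θ` can be changed by
operations with thermal environments. -/
def achievableTransitions (β : Fin n → ℝ) (θ : Matrix X (Fin n) ℝ) :
    Submonoid (Matrix X X ℝ) where
  carrier := {T | ThermallyAchievable β (diagonalCharge θ) fun ω ω' =>
    populations ω' = T *ᵥ populations ω}
  one_mem' := by
    refine Set.mem_ofPred.2 ((ThermallyAchievable.refl β _).mono fun ω ω' _ _ h => ?_)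
    rw [h, Matrix.one_mulVec]
  mul_mem' {T₁ T₂} h₁ h₂ := by
    refine Set.mem_ofPred.2 (((Set.mem_ofPred.1 h₂).comp (Set.mem_ofPred.1 h₁)).mono
      fun ω ω'' _ _ h => ?_)
    obtain ⟨ω', -, h', h''⟩ := h
    rw [h'', h', Matrix.mulVec_mulVec]

/-- The arrays by which the entries of the states of a system with charges `θ` can be multiplied
by operations with thermal environments. -/
def achievableDephasings (β : Fin n → ℝ) (θ : Matrix X (Fin n) ℝ) : Submonoid (X → X → ℝ) where
  carrier := {C | ThermallyAchievable β (diagonalCharge θ) fun ω ω' =>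
    ∀ x y, ω' x y = C x y * ω x y}
  one_mem' := by
    refine Set.mem_ofPred.2 ((ThermallyAchievable.refl β _).mono fun ω ω' _ _ h x y => ?_)
    simp [h]
  mul_mem' {C₁ C₂} h₁ h₂ := by
    refine Set.mem_ofPred.2 (((Set.mem_ofPred.1 h₁).comp (Set.mem_ofPred.1 h₂)).mono
      fun ω ω'' _ _ h x y => ?_)
    obtain ⟨ω', -, h', h''⟩ := h
    rw [h'', h', Pi.mul_apply, Pi.mul_apply, Complex.ofReal_mul]
    ring

theorem mem_achievableTransitions {T : Matrix X X ℝ} : T ∈ achievableTransitions β θ ↔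
    ThermallyAchievable β (diagonalCharge θ) fun ω ω' => populations ω' = T *ᵥ populations ω :=
  Iff.rfl

theorem mem_achievableDephasings {C : X → X → ℝ} : C ∈ achievableDephasings β θ ↔
    ThermallyAchievable β (diagonalCharge θ) fun ω ω' => ∀ x y, ω' x y = C x y * ω x y :=
  Iff.rfl

theorem permTransition_mem_achievableTransitions {y : Fin n → ℝ} (hy : y ≠ 0)
    {π : Equiv.Perm (X × Fin 2)}
    (hπ : ∀ z, θ (π z).1 + qubitLevels y (π z).2 = θ z.1 + qubitLevels y z.2) :
    permTransition π (qubitWeight β y) ∈ achievableTransitions β θ :=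
  mem_achievableTransitions.2 <| .of_qubit hy (permMatrix_mem_unitaryGroup π)
    (fun j => commute_permMatrix_diagonal fun z => congrArg _ (congrFun (hπ z) j))
    fun ω hω σ hσ hσ_eq => by rw [populations_conj_permMatrix π hω hσ, hσ_eq]

theorem diagonal_sign_mem_unitaryGroup {s : X → ℝ} (hs : ∀ x, s x * s x = 1) :
    Matrix.diagonal (fun x => (s x : ℂ)) ∈ Matrix.unitaryGroup X ℂ := by
  rw [Matrix.mem_unitaryGroup_iff, Matrix.star_eq_conjTranspose, Matrix.diagonal_conjTranspose,
    Matrix.diagonal_mul_diagonal, ← Matrix.diagonal_one]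
  congr 1
  funext x
  simp [← Complex.ofReal_mul, hs]

-- The excited level of the qubit flips the sign of the amplitude at `x₀`.
theorem signFlip_mem_achievableDephasings (hβ : β ≠ 0) (x₀ : X) :
    (fun x y => if (x = x₀ ↔ y = x₀) then 1 else qubitWeight β β 0 - qubitWeight β β 1) ∈
      achievableDephasings β θ := by
  let s : X × Fin 2 → ℝ := fun z => if z = (x₀, 1) then -1 else 1
  refine mem_achievableDephasings.2 <| .of_qubit hβ (W := Matrix.diagonal fun z => (s z : ℂ))
    (diagonal_sign_mem_unitaryGroup fun z => ?_) (fun j => Matrix.commute_diagonal _ _)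
    fun ω _ σ hσ hσ_eq x y => ?_
  · simp only [s]
    split_ifs <;> norm_num
  · have multiplier_eq : (if (x = x₀ ↔ y = x₀) then 1 else qubitWeight β β 0 - qubitWeight β β 1) =
        s (x, 0) * s (y, 0) * qubitWeight β β 0 + s (x, 1) * s (y, 1) * qubitWeight β β 1 := by
      by_cases hx : x = x₀ <;> by_cases hy : y = x₀ <;>
        simp [s, hx, hy, qubitWeight_zero_add_one, sub_eq_add_neg]
    rw [partialTraceRight_apply, Matrix.diagonal_conjTranspose, multiplier_eq]
    simp only [Fin.sum_univ_two, Matrix.mul_diagonal, Matrix.diagonal_mul,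
      Matrix.kroneckerMap_apply, hσ.apply_self_eq, hσ_eq, Pi.star_apply, Complex.star_def,
      Complex.conj_ofReal, Complex.ofReal_add, Complex.ofReal_mul]
    ring

theorem exists_uniform_mem_achievableDephasings (hβ : β ≠ 0) (θ : Matrix X (Fin n) ℝ) :
    ∃ c : ℝ, 0 ≤ c ∧ c < 1 ∧ (fun x y => if x = y then 1 else c) ∈ achievableDephasings β θ := by
  set w := qubitWeight β β
  have hw : w 0 + w 1 = 1 := qubitWeight_zero_add_one β β
  have hw_pos : ∀ i, 0 < w i := qubitWeight_pos β β
  have hδ : |w 0 - w 1| < 1 := abs_lt.2 ⟨by linarith [hw_pos 0], by linarith [hw_pos 1]⟩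
  refine ⟨(w 0 - w 1) ^ 2, sq_nonneg _, (sq_lt_one_iff_abs_lt_one _).2 hδ, ?_⟩
  convert Submonoid.prod_mem (achievableDephasings β θ) (t := Finset.univ) fun x₀ _ =>
    signFlip_mem_achievableDephasings hβ x₀ using 1
  funext x y
  rw [Finset.prod_apply, Finset.prod_apply]
  split_ifs with hxy
  · simp [hxy]
  · rw [Fintype.prod_eq_mul x y hxy fun z hz => if_pos (by simp [hz.1.symm, hz.2.symm]),
      if_neg (by simp [hxy, eq_comm]), if_neg (by simp [hxy]), sq]

end QubitOperation

section Exchange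

variable {X : Type*} {n : ℕ} {β : Fin n → ℝ} {θ : Matrix X (Fin n) ℝ} {g : X → ℝ}

/-- The distribution `g` is proportional to `exp (-u x)` where it does not vanish: the form of a
Gibbs distribution some of whose multipliers may be infinite. -/
def IsGibbsOnSupport (u g : X → ℝ) : Prop := ∃ c, ∀ x, g x ≠ 0 → g x = c * Real.exp (-u x)

theorem exists_add_qubitLevels_eq (hβ : β ≠ 0) (s t : Fin n → ℝ) :
    ∃ y ≠ 0, ∃ b c, s + qubitLevels y b = t + qubitLevels y c := by
  by_cases hst : s = t
  · exact ⟨β, hβ, 0, 0, by rw [hst]⟩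
  · exact ⟨s - t, sub_ne_zero.2 hst, 0, 1, by
      simp [show qubitLevels (s - t) 0 = 0 from rfl, show qubitLevels (s - t) 1 = s - t from rfl]⟩

theorem apply_swap_of_apply_eq {α δ : Type*} [DecidableEq α] {f : α → δ} {a b : α}
    (hab : f a = f b) (z : α) : f (Equiv.swap a b z) = f z := by
  rw [Equiv.swap_apply_def]
  split_ifs with ha hb
  · rw [ha, hab]
  · rw [hb, hab]
  · rfl

theorem IsGibbsOnSupport.detailed_balance (hg : IsGibbsOnSupport (θ *ᵥ β) g) {h k : X}
    (hh : g h ≠ 0) (hk : g k ≠ 0) {y : Fin n → ℝ} {b c : Fin 2}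
    (hbc : θ h + qubitLevels y b = θ k + qubitLevels y c) :
    g h * qubitWeight β y b = g k * qubitWeight β y c := by
  obtain ⟨C, hC⟩ := hg
  have exponent_eq : -(θ *ᵥ β) h + -(qubitLevels y *ᵥ β) b =
      -(θ *ᵥ β) k + -(qubitLevels y *ᵥ β) c := by
    simpa only [Matrix.mulVec, add_dotProduct, neg_add] using
      congrArg (fun s => -(s ⬝ᵥ β)) hbc
  rw [hC h hh, hC k hk, qubitWeight, gibbsWeight, gibbsWeight, mul_div_assoc',
    mul_div_assoc', mul_assoc, mul_assoc, ← Real.exp_add, ← Real.exp_add, exponent_eq]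

variable [Fintype X] [DecidableEq X]

/-- The achievable stochastic matrices that leave the distribution `g` invariant. -/
def equilibriumTransitions (β : Fin n → ℝ) (θ : Matrix X (Fin n) ℝ) (g : X → ℝ) :
    Submonoid (Matrix X X ℝ) where
  carrier := {T | T ∈ achievableTransitions β θ ∧ T ∈ Matrix.colStochastic ℝ X ∧ T *ᵥ g = g}
  one_mem' := ⟨one_mem _, one_mem _, Matrix.one_mulVec g⟩
  mul_mem' h₁ h₂ := ⟨mul_mem h₁.1 h₂.1, mul_mem h₁.2.1 h₂.2.1, by
    rw [← Matrix.mulVec_mulVec, h₂.2.2, h₁.2.2]⟩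

-- The permutation swaps the levels `(h, b)` and `(k, c)`, which have the same total charges.
theorem exists_exchange_mem_equilibriumTransitions (hβ : β ≠ 0)
    (hg : IsGibbsOnSupport (θ *ᵥ β) g) {h k : X} (hh : g h ≠ 0) (hk : g k ≠ 0) (hhk : h ≠ k) :
    ∃ T ∈ equilibriumTransitions β θ g, (∀ x, 0 < T x x) ∧ 0 < T h k := by
  obtain ⟨y, hy, b, c, hbc⟩ := exists_add_qubitLevels_eq hβ (θ h) (θ k)
  set w := qubitWeight β y
  have hw : w ∈ stdSimplex ℝ (Fin 2) := gibbsWeight_mem_stdSimplex _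
  set π : Equiv.Perm (X × Fin 2) := Equiv.swap (h, b) (k, c)
  refine ⟨permTransition π w, ⟨permTransition_mem_achievableTransitions hy ?_,
    permTransition_mem_colStochastic π hw, ?_⟩, fun x => ?_, ?_⟩
  · exact apply_swap_of_apply_eq (f := fun z : X × Fin 2 => θ z.1 + qubitLevels y z.2) hbc
  · have hgw (z : X × Fin 2) : g (π z).1 * w (π z).2 = g z.1 * w z.2 :=
      apply_swap_of_apply_eq (f := fun z : X × Fin 2 => g z.1 * w z.2)
        (hg.detailed_balance hh hk hbc) z
    funext x
    simp only [permTransition_mulVec, hgw, ← Finset.mul_sum, hw.2, mul_one]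
  · obtain ⟨a, hab, hac⟩ : ∃ a, (x, a) ≠ (h, b) ∧ (x, a) ≠ (k, c) := by
      by_cases hxh : x = h
      · exact ⟨b + 1, by simp, by simp [hxh, hhk]⟩
      · exact ⟨c + 1, by simp [hxh], by simp⟩
    simpa only [π, Equiv.swap_apply_of_ne_of_ne hab hac] using
      permTransition_pos π (qubitWeight_pos β y) x a
  · simpa only [π, Equiv.swap_apply_left] using permTransition_pos π (qubitWeight_pos β y) h b

theorem colStochastic_mul_apply_pos {S T : Matrix X X ℝ} (hS : S ∈ Matrix.colStochastic ℝ X)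
    (hT : T ∈ Matrix.colStochastic ℝ X) {x y z : X} (hxy : 0 < S x y) (hyz : 0 < T y z) :
    0 < (S * T) x z :=
  Finset.sum_pos' (fun _ _ => mul_nonneg (hS.1 _ _) (hT.1 _ _))
    ⟨y, Finset.mem_univ y, mul_pos hxy hyz⟩

theorem exists_mem_equilibriumTransitions_pos (hβ : β ≠ 0) (hg : IsGibbsOnSupport (θ *ᵥ β) g) :
    ∃ T ∈ equilibriumTransitions β θ g, ∀ x y, g x ≠ 0 → g y ≠ 0 → 0 < T x y := by
  have exists_pos (s : Finset (X × X)) (hs : ∀ p ∈ s, g p.1 ≠ 0 ∧ g p.2 ≠ 0 ∧ p.1 ≠ p.2) :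
      ∃ T ∈ equilibriumTransitions β θ g, (∀ x, 0 < T x x) ∧ ∀ p ∈ s, 0 < T p.1 p.2 := by
    induction s using Finset.induction_on with
    | empty => exact ⟨1, one_mem _, by simp, by simp⟩
    | insert q s _ ih =>
      rw [Finset.forall_mem_insert] at hs
      obtain ⟨T, hT, T_diag, T_pos⟩ := ih hs.2
      obtain ⟨G, hG, G_diag, G_pos⟩ :=
        exists_exchange_mem_equilibriumTransitions hβ hg hs.1.1 hs.1.2.1 hs.1.2.2
      have mul_pos {x y z : X} (hxy : 0 < T x y) (hyz : 0 < G y z) : 0 < (T * G) x z :=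
        colStochastic_mul_apply_pos hT.2.1 hG.2.1 hxy hyz
      refine ⟨T * G, mul_mem hT hG, fun x => mul_pos (T_diag x) (G_diag x), ?_⟩
      rw [Finset.forall_mem_insert]
      exact ⟨mul_pos (T_diag _) G_pos, fun p hp => mul_pos (T_pos p hp) (G_diag _)⟩
  obtain ⟨T, hT, T_diag, T_pos⟩ := exists_pos
    (Finset.univ.filter fun p => g p.1 ≠ 0 ∧ g p.2 ≠ 0 ∧ p.1 ≠ p.2) (by simp)
  refine ⟨T, hT, fun x y hx hy => ?_⟩
  obtain rfl | hxy := eq_or_ne x y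
  · exact T_diag x
  · exact T_pos (x, y) (by simp [hx, hy, hxy])

end Exchange

/-! ### Convergence of stochastic matrices to equilibrium -/

section Doeblin

variable {X : Type*} {T : Matrix X X ℝ} {g p : X → ℝ} {a : ℝ}

theorem exists_mul_le_of_pos_on_support [Finite X] (hT : ∀ x y, 0 ≤ T x y)
    (hTg : ∀ x y, g x ≠ 0 → g y ≠ 0 → 0 < T x y) :
    ∃ a > 0, a < 1 ∧ ∀ x y, g y ≠ 0 → a * g x ≤ T x y := by
  have eventually_le :
      ∀ᶠ a in nhdsWithin (0 : ℝ) (Set.Ioi 0), ∀ x y, g y ≠ 0 → a * g x ≤ T x y := by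
    refine Filter.eventually_all.2 fun x => Filter.eventually_all.2 fun y => ?_
    by_cases hgx : g x = 0
    · exact .of_forall fun a _ => by rw [hgx, mul_zero]; exact hT x y
    by_cases hgy : g y = 0
    · exact .of_forall fun a hgy' => absurd hgy hgy'
    have tendsto_zero : Filter.Tendsto (fun a => a * g x) (nhdsWithin 0 (Set.Ioi 0))
        (nhds 0) := by
      simpa using ((Filter.tendsto_id (x := nhds (0 : ℝ))).mul_const (g x)).mono_left
        nhdsWithin_le_nhds
    filter_upwards [tendsto_zero.eventually_le_const (hTg x y hgx hgy)] with a ha _ using ha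
  obtain ⟨a, ha, ha01⟩ := (eventually_le.and (Ioo_mem_nhdsGT (zero_lt_one' ℝ))).exists
  exact ⟨a, ha01.1, ha01.2, ha⟩

variable [Fintype X]

theorem abs_sub_le_of_one_sub_mul_le {r : ℝ} (hr : 0 ≤ r) (hg : g ∈ stdSimplex ℝ X)
    (hp : p ∈ stdSimplex ℝ X) (hgp : ∀ x, (1 - r) * g x ≤ p x) (x : X) : |p x - g x| ≤ r := by
  classical
  have complement_le :
      (1 - r) * ∑ y ∈ Finset.univ.erase x, g y ≤ ∑ y ∈ Finset.univ.erase x, p y := by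
    rw [Finset.mul_sum]
    exact Finset.sum_le_sum fun y _ => hgp y
  have hgx := Finset.add_sum_erase Finset.univ g (Finset.mem_univ x)
  have hpx := Finset.add_sum_erase Finset.univ p (Finset.mem_univ x)
  rw [hg.2] at hgx
  rw [hp.2] at hpx
  have g_le_one : g x ≤ 1 := hgx ▸ le_add_of_nonneg_right (Finset.sum_nonneg fun y _ => hg.1 y)
  have hrg : r * g x ≤ r := mul_le_of_le_one_right hr g_le_one
  have hrg' : 0 ≤ r * g x := mul_nonneg hr (hg.1 x)
  have hgx' : ∑ y ∈ Finset.univ.erase x, g y = 1 - g x := by linarith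
  rw [hgx'] at complement_le
  exact abs_le.2 ⟨by linarith [hgp x], by linarith⟩

theorem mulVec_eq_zero_of_mulVec_eq_self (hT : ∀ x y, 0 ≤ T x y) (hg : ∀ x, 0 ≤ g x)
    (hTg : T *ᵥ g = g) (hpg : ∀ x, g x = 0 → p x = 0) {x : X} (hx : g x = 0) :
    (T *ᵥ p) x = 0 := by
  have terms_eq_zero : ∀ y ∈ Finset.univ, T x y * g y = 0 :=
    (Finset.sum_eq_zero_iff_of_nonneg fun y _ => mul_nonneg (hT x y) (hg y)).1
      ((congrFun hTg x).trans hx)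
  refine Finset.sum_eq_zero fun y hy => ?_
  change T x y * p y = 0
  rcases mul_eq_zero.1 (terms_eq_zero y hy) with hTy | hgy
  · rw [hTy, zero_mul]
  · rw [hpg y hgy, mul_zero]

theorem doeblin_step (hg : g ∈ stdSimplex ℝ X) (hTg : T *ᵥ g = g)
    (hTa : ∀ x y, g y ≠ 0 → a * g x ≤ T x y) (hp : p ∈ stdSimplex ℝ X)
    (hpg : ∀ x, g x = 0 → p x = 0) {m : ℝ} (hm : ∀ x, m * g x ≤ p x) (x : X) :
    (m + a * (1 - m)) * g x ≤ (T *ᵥ p) x := by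
  have remainder_le : ∑ y, a * g x * (p y - m * g y) ≤ ∑ y, T x y * (p y - m * g y) := by
    refine Finset.sum_le_sum fun y _ => ?_
    by_cases hy : g y = 0
    · rw [hpg y hy, hy, mul_zero, sub_zero, mul_zero, mul_zero]
    · exact mul_le_mul_of_nonneg_right (hTa x y hy) (sub_nonneg.2 (hm y))
  have lower_eq : ∑ y, a * g x * (p y - m * g y) = a * g x * (1 - m) := by
    rw [← Finset.mul_sum, Finset.sum_sub_distrib, ← Finset.mul_sum, hp.2, hg.2, mul_one]
  have upper_eq : ∑ y, T x y * (p y - m * g y) = (T *ᵥ p) x - m * g x := by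
    have hTgx : ∑ y, T x y * g y = g x := congrFun hTg x
    simp only [mul_sub, mul_left_comm _ m, Finset.sum_sub_distrib, ← Finset.mul_sum, hTgx]
    rfl
  linarith

variable [DecidableEq X]

theorem mulVec_mem_stdSimplex (hT : T ∈ Matrix.colStochastic ℝ X) (hp : p ∈ stdSimplex ℝ X) :
    T *ᵥ p ∈ stdSimplex ℝ X := by
  refine ⟨fun x => Finset.sum_nonneg fun y _ => mul_nonneg (hT.1 x y) (hp.1 y), ?_⟩
  simp only [Matrix.mulVec, dotProduct]
  rw [Finset.sum_comm]
  simp only [← Finset.sum_mul, Matrix.sum_col_of_mem_colStochastic hT, one_mul, hp.2]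

theorem one_sub_pow_mul_le_pow_mulVec (hT : T ∈ Matrix.colStochastic ℝ X)
    (hg : g ∈ stdSimplex ℝ X) (hTg : T *ᵥ g = g) (hTa : ∀ x y, g y ≠ 0 → a * g x ≤ T x y)
    (hp : p ∈ stdSimplex ℝ X) (hpg : ∀ x, g x = 0 → p x = 0) (k : ℕ) (x : X) :
    (1 - (1 - a) ^ k) * g x ≤ (T ^ k *ᵥ p) x := by
  have pow_mulVec_eq (k : ℕ) : T ^ k *ᵥ g = g := by
    induction k with
    | zero => rw [pow_zero, Matrix.one_mulVec]
    | succ k ih => rw [pow_succ, ← Matrix.mulVec_mulVec, hTg, ih]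
  induction k generalizing x with
  | zero => simpa using hp.1 x
  | succ k ih =>
    have hTk := pow_mem hT k
    convert doeblin_step hg hTg hTa (mulVec_mem_stdSimplex hTk hp)
      (fun x => mulVec_eq_zero_of_mulVec_eq_self hTk.1 hg.1 (pow_mulVec_eq k) hpg) ih x using 1
    · ring
    · rw [Matrix.mulVec_mulVec, pow_succ']

end Doeblin

section Thermalisation

theorem exists_pos_of_mem_nhds {X : Type*} [Finite X] {A : Matrix X X ℂ} {N : Set (Matrix X X ℂ)}
    (hN : N ∈ nhds A) :
    ∃ δ > 0, ∀ B, (∀ x y, ‖B x y - A x y‖ ≤ δ) → B ∈ N := by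
  cases nonempty_fintype X
  obtain ⟨r, hr, hrN⟩ := Metric.eventually_nhds_iff (α := X → X → ℂ).1 hN
  refine ⟨r / 2, half_pos hr, fun B hB => hrN (lt_of_le_of_lt ?_ (half_lt_self hr))⟩
  exact (dist_pi_le_iff (half_pos hr).le).2 fun x => (dist_pi_le_iff (half_pos hr).le).2 fun y =>
    (dist_eq_norm _ _).trans_le (hB x y)

variable {X : Type*} [Fintype X] [DecidableEq X] {n : ℕ} {β : Fin n → ℝ} {θ : Matrix X (Fin n) ℝ}
  {g : X → ℝ}

theorem exists_equilibriumTransition_near (hβ : β ≠ 0) (hg : g ∈ stdSimplex ℝ X)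
    (hg_gibbs : IsGibbsOnSupport (θ *ᵥ β) g) {δ : ℝ} (hδ : 0 < δ) :
    ∃ T ∈ achievableTransitions β θ, ∀ p ∈ stdSimplex ℝ X, (∀ x, g x = 0 → p x = 0) →
      ∀ x, |(T *ᵥ p) x - g x| ≤ δ := by
  obtain ⟨T, ⟨hT, hT_stoch, hTg⟩, T_pos⟩ := exists_mem_equilibriumTransitions_pos hβ hg_gibbs
  obtain ⟨a, ha, ha_lt, hTa⟩ := exists_mul_le_of_pos_on_support hT_stoch.1 T_pos
  obtain ⟨k, hk⟩ := exists_pow_lt_of_lt_one hδ (sub_lt_self 1 ha)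
  refine ⟨T ^ k, pow_mem hT k, fun p hp hpg x => ?_⟩
  exact (abs_sub_le_of_one_sub_mul_le (pow_nonneg (sub_nonneg.2 ha_lt.le) k) hg
    (mulVec_mem_stdSimplex (pow_mem hT_stoch k) hp)
    (one_sub_pow_mul_le_pow_mulVec hT_stoch hg hTg hTa hp hpg k) x).trans hk.le

theorem exists_achievableDephasing_near (hβ : β ≠ 0) (θ : Matrix X (Fin n) ℝ) {δ : ℝ}
    (hδ : 0 < δ) : ∃ C ∈ achievableDephasings β θ,
      (∀ x, C x x = 1) ∧ ∀ x y, x ≠ y → |C x y| ≤ δ := by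
  obtain ⟨c, hc, hc_lt, hC⟩ := exists_uniform_mem_achievableDephasings hβ θ
  obtain ⟨k, hk⟩ := exists_pow_lt_of_lt_one hδ hc_lt
  refine ⟨_, pow_mem hC k, fun x => by simp, fun x y hxy => ?_⟩
  rw [Pi.pow_apply, Pi.pow_apply, if_neg hxy, abs_of_nonneg (pow_nonneg hc k)]
  exact hk.le

theorem thermallyAchievable_norm_sub_le (hβ : β ≠ 0) (hg : g ∈ stdSimplex ℝ X)
    (hg_gibbs : IsGibbsOnSupport (θ *ᵥ β) g) {δ : ℝ} (hδ : 0 < δ) :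
    ThermallyAchievable β (diagonalCharge θ) fun ω ω' => (∀ x, g x = 0 → populations ω x = 0) →
      ∀ x y, ‖ω' x y - ofSpectrum 1 g x y‖ ≤ δ := by
  obtain ⟨T, hT, hT_near⟩ := exists_equilibriumTransition_near hβ hg hg_gibbs hδ
  obtain ⟨C, hC, C_diag, C_offDiag⟩ := exists_achievableDephasing_near hβ θ hδ
  refine ((mem_achievableTransitions.1 hT).comp (mem_achievableDephasings.1 hC)).mono ?_
  rintro ω ω'' hω - ⟨ω', hω', populations_eq, entry_eq⟩ hωg x y
  rw [entry_eq, ofSpectrum_one]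
  obtain rfl | hxy := eq_or_ne x y
  · rw [C_diag, Matrix.diagonal_apply_eq, Complex.ofReal_one, one_mul, hω'.apply_self_eq,
      populations_eq, ← Complex.ofReal_sub, Complex.norm_real]
    exact hT_near _ hω.populations_mem_stdSimplex hωg x
  · rw [Matrix.diagonal_apply_ne _ hxy, sub_zero, norm_mul, Complex.norm_real]
    exact (mul_le_of_le_one_right (norm_nonneg _) (hω'.norm_apply_le_one x y)).trans
      (C_offDiag x y hxy)

theorem thermallyAchievable_mem_of_mem_nhds (hβ : β ≠ 0) {V : Matrix X X ℂ}
    (hV : V ∈ Matrix.unitaryGroup X ℂ) (hg : g ∈ stdSimplex ℝ X)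
    (hg_gibbs : IsGibbsOnSupport (θ *ᵥ β) g) {N : Set (Matrix X X ℂ)}
    (hN : N ∈ nhds (ofSpectrum V g)) :
    ThermallyAchievable β (fun j => ofSpectrum V (θ.col j)) fun ω ω' =>
      (∀ x, g x = 0 → populations (Vᴴ * ω * V) x = 0) → ω' ∈ N := by
  have ofSpectrum_eq (d : X → ℝ) : V * ofSpectrum 1 d * Vᴴ = ofSpectrum V d := by
    rw [ofSpectrum_one, ofSpectrum]
  have preimage_mem : (fun A => V * A * Vᴴ) ⁻¹' N ∈ nhds (ofSpectrum 1 g) :=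
    (Continuous.continuousAt (by fun_prop)).preimage_mem_nhds (by rwa [ofSpectrum_eq])
  obtain ⟨δ, hδ, mem_of_near⟩ := exists_pos_of_mem_nhds preimage_mem
  have conj_achievable := (thermallyAchievable_norm_sub_le hβ hg hg_gibbs hδ).conj hV
  simp only [diagonalCharge, ofSpectrum_eq] at conj_achievable
  refine conj_achievable.mono fun ω ω' _ _ h hωg => ?_
  simpa only [Set.mem_preimage, conj_conjTranspose_conj hV] using mem_of_near _ (h hωg)

end Thermalisation

/-! ### Limits of Gibbs states -/

section GibbsLimit

variable {X : Type*} [Fintype X] {g p : X → ℝ}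

theorem mem_stdSimplex_of_mem_closure_gibbsWeight [Nonempty X] {S : Set (X → ℝ)}
    (hg : g ∈ closure (gibbsWeight '' S)) : g ∈ stdSimplex ℝ X := by
  have image_subset : gibbsWeight '' S ⊆ stdSimplex ℝ X := by
    rintro _ ⟨u, -, rfl⟩
    exact gibbsWeight_mem_stdSimplex u
  exact closure_minimal image_subset (isClosed_stdSimplex ℝ X) hg

theorem log_gibbsWeight [Nonempty X] (u : X → ℝ) (x : X) :
    Real.log (gibbsWeight u x) = -u x - Real.log (∑ y, Real.exp (-u y)) := by
  rw [gibbsWeight, Real.log_div (Real.exp_ne_zero _) (by positivity), Real.log_exp]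

-- On the support of `g`, the logarithms of the Gibbs distributions converge to that of `g`, and
-- they range in a closed subspace.
theorem exists_isGibbsOnSupport_of_mem_closure [Nonempty X] (S : Submodule ℝ (X → ℝ))
    (hg : g ∈ closure (gibbsWeight '' S)) : ∃ u ∈ S, IsGibbsOnSupport u g := by
  let restrict : (X → ℝ) →ₗ[ℝ] ({x // g x ≠ 0} → ℝ) := LinearMap.funLeft ℝ ℝ Subtype.val
  let M : Submodule ℝ ({x // g x ≠ 0} → ℝ) := S.map restrict ⊔ Submodule.span ℝ {1}
  let logOnSupport (p : X → ℝ) (x : {x // g x ≠ 0}) : ℝ := Real.log (p x)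
  have image_subset : logOnSupport '' (gibbsWeight '' S) ⊆ M := by
    rintro _ ⟨_, ⟨u, hu, rfl⟩, rfl⟩
    refine Submodule.mem_sup.2 ⟨restrict (-u), Submodule.mem_map_of_mem (neg_mem hu),
      -Real.log (∑ y, Real.exp (-u y)) • 1,
      Submodule.smul_mem _ _ (Submodule.mem_span_singleton_self _), ?_⟩
    funext x
    simp [restrict, logOnSupport, log_gibbsWeight, sub_eq_add_neg]
  have continuousAt_log : ContinuousAt logOnSupport g :=
    continuousAt_pi.2 fun x => (continuous_apply x.1).continuousAt.log x.2
  have log_mem : logOnSupport g ∈ M :=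
    closure_minimal image_subset M.closed_of_finiteDimensional
      (mem_closure_image continuousAt_log hg)
  obtain ⟨_, ⟨u, hu, rfl⟩, _, hc, log_eq⟩ := Submodule.mem_sup.1 log_mem
  obtain ⟨c, rfl⟩ := Submodule.mem_span_singleton.1 hc
  refine ⟨-u, neg_mem hu, Real.exp c, fun x hx => ?_⟩
  have log_g_eq : u x + c = Real.log (g x) := by
    simpa [restrict, logOnSupport] using congrFun log_eq ⟨x, hx⟩
  have g_pos := ((mem_stdSimplex_of_mem_closure_gibbsWeight hg).1 x).lt_of_ne' hx
  rw [Pi.neg_apply, neg_neg, ← Real.exp_add, add_comm c, log_g_eq, Real.exp_log g_pos]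

theorem dotProduct_log_gibbsWeight [Nonempty X] (hp : p ∈ stdSimplex ℝ X) (u : X → ℝ) :
    (p ⬝ᵥ fun x => Real.log (gibbsWeight u x)) =
      -(p ⬝ᵥ u) - Real.log (∑ y, Real.exp (-u y)) := by
  simp only [dotProduct, log_gibbsWeight, mul_sub, mul_neg, Finset.sum_sub_distrib,
    Finset.sum_neg_distrib, ← Finset.sum_mul, hp.2, one_mul]

-- For Gibbs distributions `w` that converge to `g`, the means of `log w` under `p` and under `g`
-- agree. The latter converge, while the former would tend to `-∞` if `p x` were positive.
theorem eq_zero_of_mem_closure_gibbsWeight {S : Set (X → ℝ)}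
    (hg : g ∈ closure (gibbsWeight '' S)) (hp : p ∈ stdSimplex ℝ X)
    (hpg : ∀ u ∈ S, p ⬝ᵥ u = g ⬝ᵥ u) {x : X} (hx : g x = 0) : p x = 0 := by
  classical
  have : Nonempty X := ⟨x⟩
  by_contra hpx
  have p_pos := (hp.1 x).lt_of_ne' hpx
  let meanLog (w : X → ℝ) : ℝ := g ⬝ᵥ fun y => Real.log (w y)
  have continuousAt_meanLog : ContinuousAt meanLog g := by
    refine tendsto_finsetSum _ fun y _ => ?_
    by_cases hy : g y = 0
    · simp only [hy, zero_mul]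
      exact tendsto_const_nhds
    · exact (((continuous_apply y).continuousAt (x := g)).log hy).const_mul (g y)
  have meanLog_near : ∀ᶠ w in nhds g, meanLog g - 1 < meanLog w :=
    continuousAt_meanLog.eventually_const_lt (sub_one_lt _)
  have apply_near : ∀ᶠ w : X → ℝ in nhds g, w x < Real.exp ((meanLog g - 1) / p x) := by
    refine (continuous_apply x).continuousAt.eventually_lt_const ?_
    exact hx.trans_lt (Real.exp_pos _)
  obtain ⟨_, ⟨u, hu, rfl⟩, meanLog_gt, apply_lt⟩ :=
    ((mem_closure_iff_frequently.1 hg).and_eventually (meanLog_near.and apply_near)).exists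
  have meanLog_eq : meanLog (gibbsWeight u) = p ⬝ᵥ fun y => Real.log (gibbsWeight u y) := by
    rw [dotProduct_log_gibbsWeight hp, hpg u hu, ← dotProduct_log_gibbsWeight
      (mem_stdSimplex_of_mem_closure_gibbsWeight hg)]
  have meanLog_le : meanLog (gibbsWeight u) ≤ p x * Real.log (gibbsWeight u x) := by
    rw [meanLog_eq, dotProduct, ← Finset.add_sum_erase _ _ (Finset.mem_univ x)]
    refine add_le_of_nonpos_right (Finset.sum_nonpos fun y _ =>
      mul_nonpos_of_nonneg_of_nonpos (hp.1 y) (Real.log_nonpos (gibbsWeight_pos u y).le ?_))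
    exact (mem_Icc_of_mem_stdSimplex (gibbsWeight_mem_stdSimplex u) y).2
  have log_lt : Real.log (gibbsWeight u x) < (meanLog g - 1) / p x :=
    (Real.log_lt_iff_lt_exp (gibbsWeight_pos u x)).2 apply_lt
  rw [lt_div_iff₀' p_pos] at log_lt
  linarith

end GibbsLimit

section GeneralisedGibbs

variable {X : Type*} [Fintype X] [DecidableEq X] {n : ℕ} {v : Fin n → ℝ} {V γ ρ : Matrix X X ℂ}
  {q : Matrix X (Fin n) ℝ}

theorem populations_vecMul_of_mem_compatibleStates (hV : V ∈ Matrix.unitaryGroup X ℂ)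
    (hρ : ρ ∈ compatibleStates v fun j => ofSpectrum V (q.col j)) :
    populations (Vᴴ * ρ * V) ᵥ* q = v :=
  funext fun j => Complex.ofReal_injective ((hρ.1.trace_mul_ofSpectrum hV _).symm.trans (hρ.2 j))

theorem exists_ofSpectrum_of_mem_closure_gibbsState [Nonempty X]
    (hV : V ∈ Matrix.unitaryGroup X ℂ)
    (hγ : γ ∈ closure (Set.range fun lam => gibbsState lam fun j => ofSpectrum V (q.col j))) :
    ∃ g ∈ closure (gibbsWeight '' (LinearMap.range q.mulVecLin : Set (X → ℝ))),
      γ = ofSpectrum V g := by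
  have range_eq : (Set.range fun lam => gibbsState lam fun j => ofSpectrum V (q.col j)) =
      ofSpectrum V '' (gibbsWeight '' (LinearMap.range q.mulVecLin : Set (X → ℝ))) := by
    simp only [gibbsState_ofSpectrum hV, LinearMap.coe_range, ← Set.range_comp]
    rfl
  have compact_closure :
      IsCompact (closure (gibbsWeight '' (LinearMap.range q.mulVecLin : Set (X → ℝ)))) :=
    (isCompact_stdSimplex ℝ X).of_isClosed_subset isClosed_closure
      fun _ => mem_stdSimplex_of_mem_closure_gibbsWeight
  rw [range_eq, ← image_closure_of_isCompact compact_closure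
    (continuous_ofSpectrum V).continuousOn] at hγ
  obtain ⟨g, hg, rfl⟩ := hγ
  exact ⟨g, hg, rfl⟩

theorem IsGeneralisedGibbsEnsemble.mem_compatibleStates [Nonempty X] {Q : Fin n → Matrix X X ℂ}
    (hQ : IsCommutingObservables Q) (hγ : IsGeneralisedGibbsEnsemble v Q γ) :
    γ ∈ compatibleStates v Q := by
  obtain ⟨V, hV, q, rfl⟩ := hQ.exists_ofSpectrum
  obtain ⟨g, hg, rfl⟩ := exists_ofSpectrum_of_mem_closure_gibbsState hV hγ.1
  exact ⟨isDensityMatrix_ofSpectrum hV (mem_stdSimplex_of_mem_closure_gibbsWeight hg), hγ.2⟩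

end GeneralisedGibbs

section Compound

theorem IsGibbsOnSupport.prod {X A : Type*} {u g : X → ℝ} {w k : A → ℝ}
    (hg : IsGibbsOnSupport u g) (hk : IsGibbsOnSupport w k) :
    IsGibbsOnSupport (fun z : X × A => u z.1 + w z.2) fun z => g z.1 * k z.2 := by
  obtain ⟨c, hc⟩ := hg
  obtain ⟨d, hd⟩ := hk
  refine ⟨c * d, fun z hz => ?_⟩
  beta_reduce
  rw [hc _ (left_ne_zero_of_mul hz), hd _ (right_ne_zero_of_mul hz), neg_add, Real.exp_add]
  ring

theorem isGibbsOnSupport_gibbsWeight {X : Type*} [Fintype X] (u : X → ℝ) :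
    IsGibbsOnSupport u (gibbsWeight u) :=
  ⟨(∑ y, Real.exp (-u y))⁻¹, fun _ _ => div_eq_inv_mul _ _⟩

theorem prod_gibbsWeight {L : Type*} [Fintype L] [DecidableEq L] {κ : L → Type*}
    [∀ l, Fintype (κ l)] (u : ∀ l, κ l → ℝ) (a : ∀ l, κ l) :
    ∏ l, gibbsWeight (u l) (a l) = gibbsWeight (fun b : ∀ l, κ l => ∑ l, u l (b l)) a := by
  simp only [gibbsWeight, Finset.prod_div_distrib, ← Finset.sum_neg_distrib, Real.exp_sum,
    Fintype.prod_sum]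

theorem mul_mem_stdSimplex {X A : Type*} [Fintype X] [Fintype A] {p : X → ℝ} {r : A → ℝ}
    (hp : p ∈ stdSimplex ℝ X) (hr : r ∈ stdSimplex ℝ A) :
    (fun z : X × A => p z.1 * r z.2) ∈ stdSimplex ℝ (X × A) :=
  ⟨fun z => mul_nonneg (hp.1 z.1) (hr.1 z.2), by
    rw [Fintype.sum_prod_type, ← Fintype.sum_mul_sum, hp.2, hr.2, one_mul]⟩

theorem ChargedEnvironment.exists_ofSpectrum {n : ℕ} (E : ChargedEnvironment n) :
    ∃ G ∈ Matrix.unitaryGroup E.Index ℂ, ∃ r : Matrix E.Index (Fin n) ℝ,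
      (E.totalCharge = fun j => ofSpectrum G (r.col j)) ∧
      ∀ β, (tensorFamily fun l => gibbsState β (E.charge l)) =
        ofSpectrum G (gibbsWeight (r *ᵥ β)) := by
  choose G hG r hr using fun l => (E.charge_comm l).exists_ofSpectrum
  let levels : Matrix E.Index (Fin n) ℝ := Matrix.of fun a => ∑ l, r l (a l)
  have levels_mulVec (β : Fin n → ℝ) : levels *ᵥ β = fun a => ∑ l, (r l *ᵥ β) (a l) :=
    funext fun a => sum_dotProduct Finset.univ (fun l => r l (a l)) β
  refine ⟨tensorFamily G, tensorFamily_mem_unitaryGroup hG, levels, funext fun j => ?_, fun β => ?_⟩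
  · rw [E.totalCharge_eq_ofSpectrum hG hr]
    congr 1
    funext a
    exact (Finset.sum_apply j _ _).symm
  · simp only [hr, gibbsState_ofSpectrum (hG _), tensorFamily_ofSpectrum, prod_gibbsWeight,
      levels_mulVec]

theorem thermallyAchievable_compound {X : Type*} [Fintype X] [DecidableEq X] {n : ℕ}
    {β : Fin n → ℝ} (hβ : β ≠ 0) {V : Matrix X X ℂ} (hV : V ∈ Matrix.unitaryGroup X ℂ)
    {θ : Matrix X (Fin n) ℝ} {g : X → ℝ} (hg : g ∈ stdSimplex ℝ X)
    (hg_gibbs : IsGibbsOnSupport (θ *ᵥ β) g) (E : ChargedEnvironment n)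
    {N : Set (Matrix (X × E.Index) (X × E.Index) ℂ)}
    (hN : N ∈ nhds (ofSpectrum V g ⊗ₖ tensorFamily fun l => gibbsState β (E.charge l))) :
    ThermallyAchievable β (E.compoundCharge fun j => ofSpectrum V (θ.col j)) fun ω ω' =>
      (∃ ρ, IsDensityMatrix ρ ∧ (∀ x, g x = 0 → populations (Vᴴ * ρ * V) x = 0) ∧
        ∃ τ, ω = ρ ⊗ₖ τ) → ω' ∈ N := by
  obtain ⟨G, hG, r, hr, gibbs_eq⟩ := E.exists_ofSpectrum
  have : Nonempty E.Index := ⟨fun l => ⟨0, E.dim_pos l⟩⟩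
  let levels : Matrix (X × E.Index) (Fin n) ℝ := Matrix.of fun z j => θ z.1 j + r z.2 j
  have levels_mulVec :
      levels *ᵥ β = fun z => (θ *ᵥ β) z.1 + (r *ᵥ β) z.2 :=
    funext fun z => add_dotProduct (θ z.1) (r z.2) β
  have charge_eq : (E.compoundCharge fun j => ofSpectrum V (θ.col j)) =
      fun j => ofSpectrum (V ⊗ₖ G) (levels.col j) := by
    funext j
    rw [E.compoundCharge_eq_kroneckerSum, hr, kroneckerSum_ofSpectrum hV hG]
    rfl
  rw [gibbs_eq, ofSpectrum_kronecker] at hN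
  rw [charge_eq]
  refine (thermallyAchievable_mem_of_mem_nhds hβ (Matrix.kronecker_mem_unitary hV hG)
    (mul_mem_stdSimplex hg (gibbsWeight_mem_stdSimplex _)) ?_ hN).mono
    fun ω ω' _ _ h ⟨ρ, hρ, hρg, τ, hω⟩ => h fun z hz => ?_
  · rw [levels_mulVec]
    exact hg_gibbs.prod (isGibbsOnSupport_gibbsWeight _)
  · have apply_eq_zero : (Vᴴ * ρ * V) z.1 z.1 = 0 := by
      rw [(hρ.conjTranspose_conj hV).apply_self_eq,
        hρg z.1 ((mul_eq_zero.1 hz).resolve_right (gibbsWeight_pos _ _).ne'), Complex.ofReal_zero]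
    rw [populations, hω, Matrix.conjTranspose_kronecker, ← Matrix.mul_kronecker_mul,
      ← Matrix.mul_kronecker_mul, Matrix.kroneckerMap_apply, apply_eq_zero, zero_mul,
      Complex.zero_re]

end Compound

/-! ### Equivalence with the generalised Gibbs ensemble -/

section Balance

variable {X A : Type*} [Fintype X] [Fintype A]

theorem conj_mul_eq_conj_conj (U W M : Matrix X X ℂ) :
    U * W * M * (U * W)ᴴ = U * (W * M * Wᴴ) * Uᴴ := by
  simp only [Matrix.conjTranspose_mul, mul_assoc]

variable [DecidableEq X]

theorem eventually_nhds_distance_lt_and_change_lt {n : ℕ} {U : Matrix (X × A) (X × A) ℂ}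
    {τ : Matrix (X × A) (X × A) ℂ} {C : Fin n → Matrix (X × A) (X × A) ℂ} {ρf : Matrix X X ℂ}
    {ε ε' : ℝ} (hε : traceNorm (partialTraceRight (U * τ * Uᴴ) - ρf) < ε)
    (hε' : ∀ j, ‖(U * τ * Uᴴ * C j).trace - (τ * C j).trace‖ < ε')
    (Θ : Fin n → Matrix (X × A) (X × A) ℂ) :
    ∀ᶠ ω in nhds τ, traceNorm (partialTraceRight (U * ω * Uᴴ) - ρf) < ε ∧
      ∀ j, ‖(U * ω * Uᴴ * C j).trace - (τ * C j).trace +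
        ((τ * Θ j).trace - (ω * Θ j).trace)‖ < ε' := by
  have continuous_conj : Continuous fun ω => U * ω * Uᴴ :=
    (continuous_const.matrix_mul continuous_id).matrix_mul continuous_const
  have continuous_distance :
      Continuous fun ω => traceNorm (partialTraceRight (U * ω * Uᴴ) - ρf) :=
    continuous_traceNorm.comp
      ((continuous_partialTraceRight.comp continuous_conj).sub continuous_const)
  have continuous_change (j : Fin n) : Continuous fun ω =>
      ‖(U * ω * Uᴴ * C j).trace - (τ * C j).trace +
        ((τ * Θ j).trace - (ω * Θ j).trace)‖ :=
    (((continuous_conj.matrix_mul continuous_const).matrix_trace.sub continuous_const).add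
      (continuous_const.sub (continuous_id.matrix_mul continuous_const).matrix_trace)).norm
  refine (continuous_distance.continuousAt.eventually_lt_const hε).and
    (Filter.eventually_all.2 fun j => (continuous_change j).continuousAt.eventually_lt_const ?_)
  simpa using hε' j

variable [DecidableEq A]

theorem trace_conj_mul_of_commute {W K : Matrix X X ℂ} (hW : W ∈ Matrix.unitaryGroup X ℂ)
    (hWK : Commute W K) (M : Matrix X X ℂ) : (W * M * Wᴴ * K).trace = (M * K).trace := by
  rw [mul_assoc, mul_assoc, Matrix.trace_mul_comm, mul_assoc, mul_assoc, ← hWK.eq,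
    conjTranspose_mul_cancel hW]

theorem charge_change_eq {U Θ P ω ω' : Matrix X X ℂ} {T M : Matrix A A ℂ}
    {W : Matrix (X × A) (X × A) ℂ} (hU : U ∈ Matrix.unitaryGroup X ℂ)
    (hW : W ∈ Matrix.unitaryGroup (X × A) ℂ) (hWΘ : Commute W (kroneckerSum Θ M))
    (hω : ω.trace = 1) (hT : T.trace = 1) (hω' : ω' = partialTraceRight (W * (ω ⊗ₖ T) * Wᴴ)) :
    ((U ⊗ₖ (1 : Matrix A A ℂ)) * W * (ω ⊗ₖ T) * ((U ⊗ₖ (1 : Matrix A A ℂ)) * W)ᴴ *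
        kroneckerSum P M).trace - ((ω ⊗ₖ T) * kroneckerSum P M).trace =
      (U * ω' * Uᴴ * P).trace - (ω * P).trace + ((ω * Θ).trace - (ω' * Θ).trace) := by
  have conservation := trace_conj_mul_of_commute hW hWΘ (ω ⊗ₖ T)
  have commute_one : Commute (U ⊗ₖ (1 : Matrix A A ℂ)) ((1 : Matrix X X ℂ) ⊗ₖ M) := by
    rw [Commute, SemiconjBy, ← Matrix.mul_kronecker_mul, ← Matrix.mul_kronecker_mul, mul_one,
      one_mul, mul_one, one_mul]
  rw [trace_mul_kroneckerSum, trace_kronecker_mul_kroneckerSum hω hT, ← hω'] at conservation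
  rw [trace_mul_kroneckerSum, trace_kronecker_mul_kroneckerSum hω hT,
    conj_mul_eq_conj_conj, partialTraceRight_conj_kronecker_one, ← hω',
    trace_conj_mul_of_commute (kronecker_one_mem_unitaryGroup hU) commute_one]
  linear_combination conservation

end Balance

section Equivalence

variable {X : Type*} [Fintype X] [DecidableEq X] {n : ℕ} {β v : Fin n → ℝ}
  {Q : Fin n → Matrix X X ℂ} {γ ρf : Matrix X X ℂ}

namespace ChargedEnvironment

variable (E : ChargedEnvironment n)

theorem gibbsState_mem_thermalStates (β : Fin n → ℝ) :
    (fun l => gibbsState β (E.charge l)) ∈ E.thermalStates β := by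
  intro l
  have : Nonempty (Fin (E.dim l)) := ⟨⟨0, E.dim_pos l⟩⟩
  obtain ⟨V, hV, q, hq⟩ := (E.charge_comm l).exists_ofSpectrum
  have density : IsDensityMatrix (gibbsState β (E.charge l)) := by
    rw [hq, gibbsState_ofSpectrum hV]
    exact isDensityMatrix_ofSpectrum hV (gibbsWeight_mem_stdSimplex _)
  refine ⟨density, fun j => ?_⟩
  rw [thermalValue, congrFun hq j, density.trace_mul_ofSpectrum hV, Complex.ofReal_re]

theorem trace_mul_compoundCharge_eq {ρ ρ' : Matrix X X ℂ} (hρ : IsDensityMatrix ρ)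
    (hρ' : IsDensityMatrix ρ') {σ σ' : ∀ l, Matrix (Fin (E.dim l)) (Fin (E.dim l)) ℂ}
    (hσ : σ ∈ E.thermalStates β) (hσ' : σ' ∈ E.thermalStates β) {P : Fin n → Matrix X X ℂ}
    {j : Fin n} (hP : (ρ * P j).trace = (ρ' * P j).trace) :
    ((ρ ⊗ₖ tensorFamily σ) * E.compoundCharge P j).trace =
      ((ρ' ⊗ₖ tensorFamily σ') * E.compoundCharge P j).trace := by
  rw [E.compoundCharge_eq_kroneckerSum,
    trace_kronecker_mul_kroneckerSum hρ.2 (isDensityMatrix_tensorFamily hσ).2,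
    trace_kronecker_mul_kroneckerSum hρ'.2 (isDensityMatrix_tensorFamily hσ').2,
    trace_tensorFamily_mul_totalCharge hσ, trace_tensorFamily_mul_totalCharge hσ', hP]

theorem implements_append (F : ChargedEnvironment n) {ρ : Matrix X X ℂ} {ε ε' : ℝ}
    {U : Matrix ((X × E.Index) × F.Index) ((X × E.Index) × F.Index) ℂ}
    {σ : ∀ k, Matrix (Fin ((E.append F).dim k)) (Fin ((E.append F).dim k)) ℂ}
    {M : Matrix E.Index E.Index ℂ} {T : Matrix F.Index F.Index ℂ}
    (hσ : tensorFamily σ = (M ⊗ₖ T).submatrix (E.appendIndex F) (E.appendIndex F)) :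
    (E.append F).Implements Q
        (U.submatrix (regroup X (E.appendIndex F)) (regroup X (E.appendIndex F))) ρf ε ε' ρ σ ↔
      traceNorm (partialTraceRight (partialTraceRight (U * ((ρ ⊗ₖ M) ⊗ₖ T) * Uᴴ)) - ρf) ≤ ε ∧
      ∀ j, ‖(U * ((ρ ⊗ₖ M) ⊗ₖ T) * Uᴴ * F.compoundCharge (E.compoundCharge Q) j).trace -
        (((ρ ⊗ₖ M) ⊗ₖ T) * F.compoundCharge (E.compoundCharge Q) j).trace‖ ≤ ε' := by
  simp only [Implements, hσ, kronecker_submatrix_regroup, conj_submatrix,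
    partialTraceRight_submatrix_regroup, compoundCharge_append]
  simp only [Matrix.submatrix_mul_equiv, trace_submatrix]

end ChargedEnvironment

theorem IsGeneralisedGibbsEnsemble.exists_rescaledCharges [Nonempty X] (hβ : β ≠ 0)
    (hQ : IsCommutingObservables Q) (hγ : IsGeneralisedGibbsEnsemble v Q γ) :
    ∃ V ∈ Matrix.unitaryGroup X ℂ, ∃ θ : Matrix X (Fin n) ℝ, ∃ g ∈ stdSimplex ℝ X,
      γ = ofSpectrum V g ∧ IsGibbsOnSupport (θ *ᵥ β) g ∧
      ∃ w : Fin n → ℂ, ∀ ρ ∈ compatibleStates v Q,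
        (∀ x, g x = 0 → populations (Vᴴ * ρ * V) x = 0) ∧
        ∀ j, (ρ * ofSpectrum V (θ.col j)).trace = w j := by
  have γ_mem := hγ.mem_compatibleStates hQ
  obtain ⟨V, hV, q, rfl⟩ := hQ.exists_ofSpectrum
  obtain ⟨g, hg, rfl⟩ := exists_ofSpectrum_of_mem_closure_gibbsState hV hγ.1
  obtain ⟨_, ⟨μ, rfl⟩, hg_gibbs⟩ := exists_isGibbsOnSupport_of_mem_closure _ hg
  have mean_eq {ρ} (hρ : ρ ∈ compatibleStates v fun j => ofSpectrum V (q.col j)) (lam) :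
      populations (Vᴴ * ρ * V) ⬝ᵥ (q *ᵥ lam) = v ⬝ᵥ lam := by
    rw [Matrix.dotProduct_mulVec, populations_vecMul_of_mem_compatibleStates hV hρ]
  let θ : Matrix X (Fin n) ℝ := Matrix.vecMulVec (q *ᵥ μ) ((β ⬝ᵥ β)⁻¹ • β)
  have θ_mulVec : θ *ᵥ β = q *ᵥ μ := by
    have : β ⬝ᵥ β ≠ 0 := dotProduct_self_eq_zero.not.2 hβ
    rw [Matrix.vecMulVec_mulVec, smul_dotProduct, smul_eq_mul, inv_mul_cancel₀ this]
    exact one_smul _ _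
  refine ⟨V, hV, θ, g, mem_stdSimplex_of_mem_closure_gibbsWeight hg, rfl, θ_mulVec ▸ hg_gibbs,
    fun j => ((v ⬝ᵥ μ * ((β ⬝ᵥ β)⁻¹ * β j) : ℝ) : ℂ), fun ρ hρ => ⟨fun x hx => ?_, fun j => ?_⟩⟩
  · refine eq_zero_of_mem_closure_gibbsWeight hg
      (hρ.1.conjTranspose_conj hV).populations_mem_stdSimplex ?_ hx
    rintro _ ⟨lam, rfl⟩
    have γ_mean := mean_eq γ_mem lam
    rw [populations_conj_ofSpectrum hV] at γ_mean
    exact (mean_eq hρ lam).trans γ_mean.symm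
  · have col_eq : θ.col j = ((β ⬝ᵥ β)⁻¹ * β j) • (q *ᵥ μ) := by
      funext x
      simp only [θ, Matrix.col_apply, Matrix.vecMulVec_apply, Pi.smul_apply, smul_eq_mul]
      ring
    rw [hρ.1.trace_mul_ofSpectrum hV, col_eq, dotProduct_smul, mean_eq hρ, smul_eq_mul, mul_comm]

theorem MacroReachable.microReachable (hγ : γ ∈ compatibleStates v Q)
    (h : MacroReachable β v Q ρf) : MicroReachable β Q γ ρf := by
  intro ε hε ε' hε'
  obtain ⟨E, U, hU, implements⟩ := h ε hε ε' hε'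
  exact ⟨E, U, hU, implements γ hγ _ (E.gibbsState_mem_thermalStates β)⟩

-- First drive the compound of system and environment to the thermal state, at no cost in charges,
-- and then apply the unitary that works for the thermal state.
theorem MicroReachable.macroReachable [Nonempty X] (hβ : β ≠ 0) (hQ : IsCommutingObservables Q)
    (hγ : IsGeneralisedGibbsEnsemble v Q γ) (h : MicroReachable β Q γ ρf) :
    MacroReachable β v Q ρf := by
  have γ_mem := hγ.mem_compatibleStates hQ
  obtain ⟨V, hV, θ, g, hg, rfl, hg_gibbs, w, compatible⟩ := hγ.exists_rescaledCharges hβ hQ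
  intro ε hε ε' hε'
  obtain ⟨E, U, hU, distance_le, change_le⟩ := h (ε / 2) (half_pos hε) (ε' / 2) (half_pos hε')
  have thermal := E.gibbsState_mem_thermalStates β
  set τ := ofSpectrum V g ⊗ₖ tensorFamily fun l => gibbsState β (E.charge l)
  set Θ := E.compoundCharge fun j => ofSpectrum V (θ.col j)
  obtain ⟨F, W, hW, W_commute, near⟩ := thermallyAchievable_compound hβ hV hg hg_gibbs E
    (eventually_nhds_distance_lt_and_change_lt (distance_le.trans_lt (half_lt_self hε))
      (fun j => (change_le j).trans_lt (half_lt_self hε')) Θ)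
  refine ⟨E.append F, ((U ⊗ₖ (1 : Matrix F.Index F.Index ℂ)) * W).submatrix
    (regroup X (E.appendIndex F)) (regroup X (E.appendIndex F)),
    submatrix_mem_unitaryGroup _ (mul_mem (kronecker_one_mem_unitaryGroup hU) hW),
    fun ρ hρ σ hσ => ?_⟩
  obtain ⟨σE, hσE, σF, hσF, hσ_eq⟩ := E.exists_tensorFamily_append F hσ
  set ω := ρ ⊗ₖ tensorFamily σE with hω
  have ω_density : IsDensityMatrix ω :=
    hρ.1.kronecker (ChargedEnvironment.isDensityMatrix_tensorFamily hσE)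
  obtain ⟨distance_lt, change_lt⟩ :=
    near ω ω_density σF hσF ⟨ρ, hρ.1, (compatible ρ hρ).1, _, hω⟩
  refine (E.implements_append F hσ_eq).2 ⟨?_, fun j => ?_⟩
  · rw [conj_mul_eq_conj_conj, partialTraceRight_conj_kronecker_one]
    exact distance_lt.le
  · have charge_eq : (ω * E.compoundCharge Q j).trace = (τ * E.compoundCharge Q j).trace :=
      E.trace_mul_compoundCharge_eq hρ.1 γ_mem.1 hσE thermal ((hρ.2 j).trans (γ_mem.2 j).symm)
    have rescaledCharge_eq : (ω * Θ j).trace = (τ * Θ j).trace :=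
      E.trace_mul_compoundCharge_eq hρ.1 γ_mem.1 hσE thermal
        (((compatible ρ hρ).2 j).trans ((compatible _ γ_mem).2 j).symm)
    rw [F.compoundCharge_eq_kroneckerSum, charge_change_eq hU hW
      (F.compoundCharge_eq_kroneckerSum Θ j ▸ W_commute j) ω_density.2
      (ChargedEnvironment.isDensityMatrix_tensorFamily hσF).2 rfl, charge_eq, rescaledCharge_eq]
    exact (change_lt j).le

end Equivalence

theorem theorem2_general {ι : Type*} [Fintype ι] [DecidableEq ι] [Nonempty ι] {n : ℕ}
    {β : Fin n → ℝ} (hβ : β ≠ 0) {Q : Fin n → Matrix ι ι ℂ} (hQ : IsCommutingObservables Q)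
    {v : Fin n → ℝ} {γ : Matrix ι ι ℂ} (hγ : IsGeneralisedGibbsEnsemble v Q γ) :
    OperationallyEquivalent β v Q γ :=
  fun _ _ => ⟨fun h => h.microReachable (hγ.mem_compatibleStates hQ),
    fun h => h.macroReachable hβ hQ hγ⟩

end

theorem theorem2 {ι : Type*} [Fintype ι] [DecidableEq ι] [Nonempty ι]
    {n : ℕ} (hn : 0 < n) (β : Fin n → ℝ) (hβ : ∀ j, β j ≠ 0)
    (Q : Fin n → Matrix ι ι ℂ) (hQ : IsCommutingObservables Q)
    (v : Fin n → ℝ) (γ : Matrix ι ι ℂ) (hγ : IsGeneralisedGibbsEnsemble v Q γ) :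
    OperationallyEquivalent β v Q γ :=
  theorem2_general (fun h => hβ ⟨0, hn⟩ (congrFun h _)) hQ hγ
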